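/- Let $0<d<n$ and $p\le n$. A \emph{quantum fan} $(\Delta,v)$ in $\mathbb R^d$, in a finitely generated subgroup $\Gamma\subset\mathbb R^d$ spanning $\mathbb R^d$, is a fan $\Delta$ of strongly convex cones generated by finitely many elements of $\Gamma$ (faces of cones are cones, two cones meet in a common face, $0$ is a cone), with a chosen generator $v_i\in\Gamma\setminus\{0\}$ of each $1$-cone. A \emph{calibrated quantum fan} $(\Delta,h)$ is such a $\Delta$ with a homomorphism $h:\mathbb Z^n\to\mathbb R^d$ with image $\Gamma$ and disjoint subsets $I,J\subset\{1,\dots,n\}$ such that the $h(e_i)$, $i\in I$, are generators of the $1$-cones, one for each $1$-cone, and the $h(e_i)$, $i\notin J$, span $\mathbb R^d$; it has \emph{maximal length} if $|J|=n-|I|$. Let $\Delta_h$ be the fan in $\mathbb R^n$ (with lattice $\mathbb Z^n$) of the cones generated by $\{e_i: i\in I,\ h(e_i)\in\sigma\}$, $\sigma\in\Delta$. A morphism $(\Delta,h)\to(\Delta',h')$ is a pair $(L,H)$ of a linear map $L$ and a homomorphism $H:\mathbb Z^n\to\mathbb Z^{n'}$ with $Lh=h'H$, such that: $L$ maps $\Gamma$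 into $\Gamma'$, each cone of $\Delta$ into a cone of $\Delta'$, and each generator $v_i$, whenever $L(v_i)$ lies in $\sigma'\in\Delta'$, to an $\mathbb N$-combination of the generators $v'_j$ in $\sigma'$; $H$ satisfies the same conditions for $\Delta_h,\Delta'_{h'}$ and their generators $e_i$; $H(e_i)\in\bigoplus_{j\notin J'}\mathbb Z e_j$ for $i\notin J$; and $H(e_i)=e_{\sigma(i)}$ for $i\in J$, for some map $\sigma:J\to J'$. Simplicial calibrated quantum fans encode the calibrated quantum toric stacks, and isomorphism of calibrated quantum toric stacks means isomorphism of their calibrated quantum fans. The \emph{combinatorial type} of a quantum fan with generators $v_1,\dots,v_p$ is the set of all $K\subset\{1,\dots,p\}$ such that the cone generated by $(v_i)_{i\in K}$ belongs to $\Delta$; two types are equivalent if they differ by a permutation of $\{1,\dots,p\}$. Let $D$ be the combinatorial type of a simplicial quantum fan in $\mathbb R^d$ with $p$ $1$-cones, and assume that $D$ contains a cone of dimension $d$. Let $\mathscr M(D,n,d)$ be the moduli space of calibrated quantum toric stacks of maximal length and combinatorial type $D$, that is, the set of isomorphism classes of simplicial calibrated quantum fans of maximal length, with $h:\mathbb Z^n\to\mathbb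 R^d$ and combinatorial type equivalent to $D$. One can renumber the $1$-cones so that $\{1,\dots,d\}\in D$. For any such numbering, let $U\subset(\mathbb R^d)^{n-d}$ be the set of the $\hbar:\mathbb Z^{n-d}\to\mathbb R^d$ such that $h(x,y)=x+\hbar(y)$ is $D$-realizable: with $v_i=h(e_i)$, there is a simplicial fan with $1$-cone generators $v_1=e_1,\dots,v_d=e_d,v_{d+1},\dots,v_p$ and combinatorial type $D$; such an $\hbar$ defines a calibrated quantum fan with $I=\{1,\dots,p\}$ and $J=\{p+1,\dots,n\}$. Endow $\mathscr M(D,n,d)$ with the quotient topology from the sets $U$ (the finest topology making the maps $U\to\mathscr M(D,n,d)$, for all such numberings, continuous). Then: (1) $U$ is open in $(\mathbb R^d)^{n-d}$, and $U\to\mathscr M(D,n,d)$ is a topological quotient map, so that $\mathscr M(D,n,d)$ is homeomorphic to the quotient of $U$ by the equivalence relation $$\hbar\sim\hbar'\iff\exists (s,t)\in\mathfrak S_p\times\mathfrak S_{n-p}\text{ such that } s \text{ preserves } D,\ L=(v_{s(1)},\dots,v_{s(d)})^{-1}\text{ exists, and } h'=LhH^{-1},$$ where $H=\begin{pmatrix}s&0\\0&t\end{pmatrix}^{-1}$,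 so that $H$ sends $e_{s(i)}$ to $e_i$ for $i\le p$. (2) $\mathscr M(D,n,d)$ has a structure of real orbifold of dimension $d(n-d)$: it is the orbit space of a proper étale Lie groupoid with finite isotropy groups, whose manifold of objects is $U$ and whose arrows from $\hbar$ to $\hbar'$ are the pairs $(s,t)$ as in (1), composed as in $\mathfrak S_p\times\mathfrak S_{n-p}$. In particular the isotropy group of $\hbar$ is a subgroup of $\mathfrak S_p\times\mathfrak S_{n-p}$. -/

import Mathlib

open CategoryTheory Topology
open scoped Manifold ContDiff

noncomputable section

/-! ## Quantum fans -/

/-- The space `ℝ^d`. -/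
abbrev Vec (d : ℕ) : Type := EuclideanSpace ℝ (Fin d)

/-- The data underlying a quantum fan in `ℝ^d` whose `1`-cones are indexed by `ι`: a subgroup `Γ`
of `ℝ^d`, a collection of cones, and a vector for each `1`-cone. -/
structure FanData (d : ℕ) (ι : Type) where
  Γ : AddSubgroup (Vec d)
  cones : Set (PointedCone ℝ (Vec d))
  gen : ι → Vec d

namespace FanData

variable {d d' d'' : ℕ} {ι ι' ι'' : Type}

/-- `F` is a quantum fan `(Δ, v)` in `Γ`, where `Γ` is a finitely generated subgroup that spans
`ℝ^d`: the cones are strongly convex, generated by finitely many elements of `Γ`, a face of a cone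
is a cone, `0` is a cone, the intersection of two cones is a face of both, and `v` chooses one
nonzero generator in `Γ` for every `1`-cone. -/
structure IsQuantumFan (F : FanData d ι) : Prop where
  fg : F.Γ.FG
  span_eq_top : Submodule.span ℝ (F.Γ : Set (Vec d)) = ⊤
  polyhedral : ∀ σ ∈ F.cones, ∃ s : Set (Vec d),
    s.Finite ∧ s ⊆ F.Γ ∧ σ = PointedCone.hull ℝ s
  strongly_convex : ∀ σ ∈ F.cones, ∀ x ∈ σ, -x ∈ σ → x = 0
  zero_mem : ⊥ ∈ F.cones
  face_mem : ∀ σ ∈ F.cones, ∀ τ : PointedCone ℝ (Vec d), τ.IsFaceOf σ → τ ∈ F.cones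
  inter_face : ∀ σ ∈ F.cones, ∀ τ ∈ F.cones, (σ ⊓ τ).IsFaceOf σ ∧ (σ ⊓ τ).IsFaceOf τ
  gen_mem : ∀ i, F.gen i ∈ F.Γ
  gen_ne_zero : ∀ i, F.gen i ≠ 0
  ray_mem : ∀ i, PointedCone.hull ℝ {F.gen i} ∈ F.cones
  ray_injective : Function.Injective fun i => PointedCone.hull ℝ {F.gen i}
  ray_surjective : ∀ σ ∈ F.cones,
    Module.finrank ℝ (Submodule.span ℝ (σ : Set (Vec d))) = 1 →
      ∃ i, σ = PointedCone.hull ℝ {F.gen i}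

/-- Every cone is a cone over a simplex. -/
def IsSimplicial (F : FanData d ι) : Prop :=
  ∀ σ ∈ F.cones, PointedCone.IsSimplicial σ

/-- The combinatorial type `comb(Δ)`: the sets `K` of indices of `1`-cones such that the cone
generated by `v_i`, `i ∈ K`, is a cone of the fan. -/
def comb (F : FanData d ι) : Set (Finset ι) :=
  {K | PointedCone.hull ℝ (F.gen '' (K : Set ι)) ∈ F.cones}

/-- Morphisms of quantum fans. In the third condition, the generators of the `1`-cones of a
cone `σ'` of the target are the `v'_j` that lie in `σ'`. -/
structure IsMorphism (F : FanData d ι) (F' : FanData d' ι') (L : Vec d →ₗ[ℝ] Vec d') : Prop where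
  map_lattice : ∀ x ∈ F.Γ, L x ∈ F'.Γ
  map_cone : ∀ σ ∈ F.cones, ∃ σ' ∈ F'.cones, ∀ x ∈ σ, L x ∈ σ'
  map_gen : ∀ i, ∀ σ' ∈ F'.cones, L (F.gen i) ∈ σ' →
    L (F.gen i) ∈ AddSubmonoid.closure {w | ∃ j, F'.gen j ∈ σ' ∧ w = F'.gen j}

theorem IsMorphism.refl (F : FanData d ι) : F.IsMorphism F LinearMap.id where
  map_lattice _ hx := hx
  map_cone σ hσ := ⟨σ, hσ, fun _ hx => hx⟩
  map_gen i _ _ h := AddSubmonoid.subset_closure ⟨i, h, rfl⟩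

theorem IsMorphism.comp {F : FanData d ι} {F' : FanData d' ι'} {F'' : FanData d'' ι''}
    {L : Vec d →ₗ[ℝ] Vec d'} {L' : Vec d' →ₗ[ℝ] Vec d''}
    (hA : ∀ i, ∃ σ ∈ F.cones, F.gen i ∈ σ)
    (hB : ∀ σ ∈ F''.cones, ∀ τ ∈ F''.cones, ∀ x ∈ τ, ∀ y ∈ τ, x + y ∈ σ → x ∈ σ)
    (h' : F'.IsMorphism F'' L') (h : F.IsMorphism F' L) :
    F.IsMorphism F'' (L' ∘ₗ L) where
  map_lattice x hx := h'.map_lattice _ (h.map_lattice x hx)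
  map_cone σ hσ := by
    obtain ⟨σ', hσ', h1⟩ := h.map_cone σ hσ
    obtain ⟨σ'', hσ'', h2⟩ := h'.map_cone σ' hσ'
    exact ⟨σ'', hσ'', fun x hx => h2 _ (h1 x hx)⟩
  map_gen i σ'' hσ'' hi := by
    obtain ⟨σ, hσ, hiσ⟩ := hA i
    obtain ⟨σ', hσ', h1⟩ := h.map_cone σ hσ
    obtain ⟨τ, hτ, h2⟩ := h'.map_cone σ' hσ'
    have key := h.map_gen i σ' hσ' (h1 _ hiσ)
    have hcl : ∀ x ∈ AddSubmonoid.closure {w | ∃ j, F'.gen j ∈ σ' ∧ w = F'.gen j},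
        L' x ∈ τ ∧ (L' x ∈ σ'' →
          L' x ∈ AddSubmonoid.closure {w | ∃ j, F''.gen j ∈ σ'' ∧ w = F''.gen j}) := by
      intro x hx
      induction hx using AddSubmonoid.closure_induction with
      | mem x hx =>
        obtain ⟨j, hj, rfl⟩ := hx
        exact ⟨h2 _ hj, fun hm => h'.map_gen j σ'' hσ'' hm⟩
      | zero => simp
      | add x y _ _ hx hy =>
        rw [map_add]
        refine ⟨add_mem hx.1 hy.1, fun hm => ?_⟩
        have hx' := hB σ'' hσ'' τ hτ _ hx.1 _ hy.1 hm
        have hy' := hB σ'' hσ'' τ hτ _ hy.1 _ hx.1 (by rwa [add_comm])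
        exact add_mem (hx.2 hx') (hy.2 hy')
    exact (hcl _ key).2 hi

theorem IsQuantumFan.mem_of_add_mem {F : FanData d ι} (hF : F.IsQuantumFan) :
    ∀ σ ∈ F.cones, ∀ τ ∈ F.cones, ∀ x ∈ τ, ∀ y ∈ τ, x + y ∈ σ → x ∈ σ := by
  intro σ hσ τ hτ x hx y hy hxy
  exact ((hF.inter_face σ hσ τ hτ).2.mem_of_add_mem_left hx hy
    ⟨hxy, add_mem hx hy⟩).1

/-- A ray of a simplicial cone spanned by one of its generators is a face. -/
theorem hull_singleton_isFaceOf {s : Set (Vec d)} (hs : LinearIndepOn ℝ id s) {x : Vec d}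
    (hx : x ∈ s) : (PointedCone.hull ℝ {x}).IsFaceOf (PointedCone.hull ℝ s) := by
  refine ⟨Submodule.span_mono (by simpa using hx), ?_⟩
  intro y z a hy hz ha hyz
  obtain ⟨c, hc, hc0, hcy⟩ := PointedCone.mem_hull_set.1 hy
  obtain ⟨e, he, he0, hez⟩ := PointedCone.mem_hull_set.1 hz
  obtain ⟨t, ht⟩ := Submodule.mem_span_singleton.1 hyz
  have hl := linearIndepOn_iff.1 hs (a • c + e - Finsupp.single x (t : ℝ)) ?_ ?_
  · have hci : ∀ i, i ≠ x → c i = 0 := by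
      intro i hi
      have h1 := DFunLike.congr_fun hl i
      have h2 : a * c i + e i = 0 := by
        simpa [Finsupp.single_apply, hi.symm] using h1
      have h3 : 0 ≤ a * c i := mul_nonneg ha.le (hc0 i)
      have h4 := he0 i
      have h5 : a * c i = 0 := by
        have : (0 : ℝ) ≤ e i := h4
        linarith
      exact (mul_eq_zero.1 h5).resolve_left ha.ne'
    have hc1 : c = Finsupp.single x (c x) := by
      ext i
      by_cases hi : i = x
      · subst hi; simp
      · simp [hci i hi, Ne.symm hi]
    rw [← hcy, hc1, Finsupp.sum_single_index (by simp)]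
    exact PointedCone.smul_mem _ (hc0 x) (Submodule.subset_span rfl)
  · refine Submodule.sub_mem _ (Submodule.add_mem _ (Submodule.smul_mem _ _ ?_) ?_) ?_
    · exact (Finsupp.mem_supported _ _).2 hc
    · exact (Finsupp.mem_supported _ _).2 he
    · exact Finsupp.single_mem_supported _ _ hx
  · have e1 : Finsupp.linearCombination ℝ (id : Vec d → Vec d) c = y := hcy
    have e2 : Finsupp.linearCombination ℝ (id : Vec d → Vec d) e = z := hez
    have e3 : (t : ℝ) • x = a • y + z := ht
    simp [map_sub, map_add, e1, e2, e3]

/-- A simplicial quantum fan is determined by its generators and its combinatorial type. -/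
theorem IsQuantumFan.cones_eq [Finite ι] {F : FanData d ι} (hF : F.IsQuantumFan)
    (hS : F.IsSimplicial) :
    F.cones = {σ | ∃ K ∈ F.comb, σ = PointedCone.hull ℝ (F.gen '' (K : Set ι))} := by
  ext σ
  constructor
  · intro hσ
    obtain ⟨s, -, hli, rfl⟩ := hS σ hσ
    have hray : ∀ x ∈ s, ∃ i, PointedCone.hull ℝ {x} = PointedCone.hull ℝ {F.gen i} := by
      intro x hx
      refine hF.ray_surjective _ (hF.face_mem _ hσ _ (hull_singleton_isFaceOf hli hx)) ?_
      have hx0 : x ≠ 0 := hli.ne_zero hx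
      have : Submodule.span ℝ ((PointedCone.hull ℝ {x} : PointedCone ℝ (Vec d)) : Set (Vec d))
          = Submodule.span ℝ {x} :=
        Submodule.span_span_of_tower _ ℝ _
      rw [this, finrank_span_singleton hx0]
    have hfin := Set.toFinite {i | ∃ x ∈ s, PointedCone.hull ℝ {x} = PointedCone.hull ℝ {F.gen i}}
    have heq : PointedCone.hull ℝ s =
        PointedCone.hull ℝ (F.gen '' (hfin.toFinset : Set ι)) := by
      apply le_antisymm
      · refine Submodule.span_le.2 fun x hx => ?_
        obtain ⟨i, hi⟩ := hray x hx
        have h1 : x ∈ PointedCone.hull ℝ {F.gen i} := hi ▸ Submodule.subset_span rfl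
        refine Submodule.span_mono ?_ h1
        simpa using ⟨i, ⟨x, hx, hi⟩, rfl⟩
      · refine Submodule.span_le.2 ?_
        rintro _ ⟨i, hi, rfl⟩
        obtain ⟨x, hx, hxi⟩ : ∃ x ∈ s,
            PointedCone.hull ℝ {x} = PointedCone.hull ℝ {F.gen i} := by simpa using hi
        have h1 : F.gen i ∈ PointedCone.hull ℝ {x} := hxi ▸ Submodule.subset_span rfl
        exact Submodule.span_mono (by simpa using hx) h1
    exact ⟨hfin.toFinset, by change PointedCone.hull ℝ _ ∈ F.cones; rw [← heq]; exact hσ, heq⟩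
  · rintro ⟨K, hK, rfl⟩
    exact hK

end FanData

/-! ## Calibrated quantum fans -/

/-- The inclusion `ℤ^n → ℝ^n`. -/
def intVec (n : ℕ) : (Fin n → ℤ) →+ Vec n where
  toFun x := WithLp.toLp 2 fun i => (x i : ℝ)
  map_zero' := by ext; simp
  map_add' x y := by ext; simp

/-- The `ℝ`-linear extension `ℝ^n → ℝ^m` of a homomorphism `ℤ^n → ℤ^m`. -/
def realExt {n m : ℕ} (H : (Fin n → ℤ) →+ (Fin m → ℤ)) : Vec n →ₗ[ℝ] Vec m :=
  (EuclideanSpace.basisFun (Fin n) ℝ).toBasis.constr ℝ fun i => intVec m (H (Pi.single i 1))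

theorem intVec_single {n : ℕ} (i : Fin n) :
    intVec n (Pi.single i 1) = EuclideanSpace.basisFun (Fin n) ℝ i := by
  ext j
  simp [intVec, Pi.single_apply]

theorem realExt_intVec {n m : ℕ} (H : (Fin n → ℤ) →+ (Fin m → ℤ)) (x : Fin n → ℤ) :
    realExt H (intVec n x) = intVec m (H x) := by
  have : (realExt H).toAddMonoidHom.comp (intVec n) = (intVec m).comp H := by
    refine AddMonoidHom.functions_ext' _ _ _ fun i => AddMonoidHom.ext_int ?_
    simp only [AddMonoidHom.comp_apply, AddMonoidHom.single_apply]
    rw [intVec_single]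
    simp [realExt]
  exact DFunLike.congr_fun this x

theorem realExt_id (n : ℕ) : realExt (AddMonoidHom.id (Fin n → ℤ)) = LinearMap.id := by
  refine (EuclideanSpace.basisFun (Fin n) ℝ).toBasis.ext fun i => ?_
  rw [OrthonormalBasis.coe_toBasis, ← intVec_single, realExt_intVec]
  rfl

theorem realExt_comp {n m k : ℕ} (H' : (Fin m → ℤ) →+ (Fin k → ℤ))
    (H : (Fin n → ℤ) →+ (Fin m → ℤ)) :
    realExt (H'.comp H) = realExt H' ∘ₗ realExt H := by
  refine (EuclideanSpace.basisFun (Fin n) ℝ).toBasis.ext fun i => ?_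
  rw [OrthonormalBasis.coe_toBasis, ← intVec_single, realExt_intVec, LinearMap.comp_apply,
    realExt_intVec, realExt_intVec]
  rfl

/-- The fan data `(Δ, (h(e_i))_{i ∈ I})` in `Γ = h(ℤ^n)`. -/
def calibratedFanData {d n : ℕ} (Δ : Set (PointedCone ℝ (Vec d))) (h : (Fin n → ℤ) →+ Vec d)
    (I : Finset (Fin n)) : FanData d I where
  Γ := h.range
  cones := Δ
  gen i := h (Pi.single i.1 1)

/-- A calibrated quantum fan `(Δ, h)`: the calibration is an epimorphism `h` of `ℤ^n` onto
`Γ = h(ℤ^n)`, with a set `J` of virtual generators such that the `h(e_i)`, `i ∉ J`, span `ℝ^d`;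
the set of generators `I` is disjoint from `J`, and the `h(e_i)`, `i ∈ I`, generate the `1`-cones
of the fan, one for each `1`-cone. -/
structure CalibratedQuantumFan (d n : ℕ) where
  cones : Set (PointedCone ℝ (Vec d))
  h : (Fin n → ℤ) →+ Vec d
  I : Finset (Fin n)
  J : Finset (Fin n)
  isQuantumFan : (calibratedFanData cones h I).IsQuantumFan
  span_eq_top : Submodule.span ℝ {w | ∃ i, i ∉ J ∧ w = h (Pi.single i 1)} = ⊤
  disjoint : Disjoint I J

namespace CalibratedQuantumFan

variable {d n d' n' d'' n'' : ℕ}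

/-- The underlying quantum fan `(Δ, v)`. -/
def fan (F : CalibratedQuantumFan d n) : FanData d F.I :=
  calibratedFanData F.cones F.h F.I

/-- The associated classical fan `(Δ_h, e_I)` in `ℝ^n` with lattice `ℤ^n`: to a cone `σ` of `Δ`
corresponds the cone generated by the `e_i`, `i ∈ I`, such that `h(e_i) ∈ σ`. -/
def assocFan (F : CalibratedQuantumFan d n) : FanData n F.I where
  Γ := (intVec n).range
  cones := {c | ∃ σ ∈ F.cones, c = PointedCone.hull ℝ
    {w | ∃ i ∈ F.I, F.h (Pi.single i 1) ∈ σ ∧ w = intVec n (Pi.single i 1)}}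
  gen i := intVec n (Pi.single i.1 1)

theorem mem_coordCone (S : Set (Fin n)) (x : Vec n) :
    x ∈ PointedCone.hull ℝ {w | ∃ i ∈ S, w = intVec n (Pi.single i 1)} ↔
      (∀ i, 0 ≤ x i) ∧ ∀ i, i ∉ S → x i = 0 := by
  constructor
  · intro hx
    induction hx using Submodule.span_induction with
    | mem x hx =>
      obtain ⟨j, hj, rfl⟩ := hx
      refine ⟨fun i => ?_, fun i hi => ?_⟩
      · by_cases hij : i = j <;> simp [intVec, Pi.single_apply, hij]
      · have : i ≠ j := fun h => hi (h ▸ hj)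
        simp [intVec, Pi.single_apply, this]
    | zero => simp
    | add x y _ _ hx hy =>
      exact ⟨fun i => add_nonneg (hx.1 i) (hy.1 i), fun i hi => by
        simp [hx.2 i hi, hy.2 i hi]⟩
    | smul a x _ hx =>
      refine ⟨fun i => ?_, fun i hi => ?_⟩
      · exact mul_nonneg a.2 (hx.1 i)
      · change (a : ℝ) * x i = 0
        rw [hx.2 i hi, mul_zero]
  · rintro ⟨h0, hS⟩
    have hx : x = ∑ i, x i • intVec n (Pi.single i 1) := by
      simp_rw [intVec_single]
      have := (EuclideanSpace.basisFun (Fin n) ℝ).sum_repr x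
      simpa using this.symm
    rw [hx]
    refine sum_mem fun i _ => ?_
    by_cases hi : i ∈ S
    · exact PointedCone.smul_mem _ (h0 i) (Submodule.subset_span ⟨i, hi, rfl⟩)
    · rw [hS i hi, zero_smul]; exact zero_mem _

theorem assocFan_mem_of_add_mem (F : CalibratedQuantumFan d n) :
    ∀ σ ∈ F.assocFan.cones, ∀ τ ∈ F.assocFan.cones, ∀ x ∈ τ, ∀ y ∈ τ, x + y ∈ σ → x ∈ σ := by
  rintro _ ⟨σ, -, rfl⟩ _ ⟨τ, -, rfl⟩ x hx y hy hxy
  have e : ∀ σ : PointedCone ℝ (Vec d),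
      {w | ∃ i ∈ F.I, F.h (Pi.single i 1) ∈ σ ∧ w = intVec n (Pi.single i 1)} =
      {w | ∃ i ∈ {i | i ∈ F.I ∧ F.h (Pi.single i 1) ∈ σ}, w = intVec n (Pi.single i 1)} := by
    intro σ; ext w; simp [and_assoc]
  rw [e, mem_coordCone] at hx hy hxy ⊢
  refine ⟨hx.1, fun i hi => ?_⟩
  have h1 : x i + y i = 0 := hxy.2 i hi
  linarith [hx.1 i, hy.1 i]

/-- Morphisms `(L, H)` of calibrated quantum fans. -/
@[ext]
structure Hom (F : CalibratedQuantumFan d n) (F' : CalibratedQuantumFan d' n') where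
  L : Vec d →ₗ[ℝ] Vec d'
  H : (Fin n → ℤ) →+ (Fin n' → ℤ)
  isMorphism_L : F.fan.IsMorphism F'.fan L
  isMorphism_H : F.assocFan.IsMorphism F'.assocFan (realExt H)
  comm : ∀ x, L (F.h x) = F'.h (H x)
  map_notMem : ∀ i, i ∉ F.J → ∀ j ∈ F'.J, H (Pi.single i 1) j = 0
  map_virtual : ∃ s : F.J → F'.J, ∀ i : F.J, H (Pi.single i.1 1) = Pi.single (s i).1 1

/-- The identity morphism. -/
def Hom.id (F : CalibratedQuantumFan d n) : Hom F F where
  L := LinearMap.id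
  H := AddMonoidHom.id _
  isMorphism_L := FanData.IsMorphism.refl _
  isMorphism_H := by rw [realExt_id]; exact FanData.IsMorphism.refl _
  comm _ := rfl
  map_notMem i hi j hj := by
    have : j ≠ i := fun h => hi (h ▸ hj)
    simp [this]
  map_virtual := ⟨_root_.id, fun _ => rfl⟩

/-- The composition of two morphisms. -/
def Hom.comp {F : CalibratedQuantumFan d n} {F' : CalibratedQuantumFan d' n'}
    {F'' : CalibratedQuantumFan d'' n''} (f : Hom F F') (g : Hom F' F'') : Hom F F'' where
  L := g.L ∘ₗ f.L
  H := g.H.comp f.H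
  isMorphism_L := FanData.IsMorphism.comp
    (fun i => ⟨_, F.isQuantumFan.ray_mem i, Submodule.subset_span rfl⟩)
    F''.isQuantumFan.mem_of_add_mem g.isMorphism_L f.isMorphism_L
  isMorphism_H := by
    rw [realExt_comp]
    exact FanData.IsMorphism.comp
      (fun i => ⟨_, ⟨_, F.isQuantumFan.ray_mem i, rfl⟩,
        Submodule.subset_span ⟨i.1, i.2, Submodule.subset_span rfl, rfl⟩⟩)
      F''.assocFan_mem_of_add_mem g.isMorphism_H f.isMorphism_H
  comm x := by
    rw [LinearMap.comp_apply, f.comm, g.comm]; rfl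
  map_notMem i hi j hj := by
    have key : ∀ x : Fin n' → ℤ, (∀ k ∈ F'.J, x k = 0) → g.H x j = 0 := by
      intro x hx
      have hsum : x = ∑ k, x k • (Pi.single k 1 : Fin n' → ℤ) := by
        ext l; simp [Finset.sum_apply, Pi.single_apply]
      rw [hsum, map_sum, Finset.sum_apply]
      refine Finset.sum_eq_zero fun k _ => ?_
      rw [map_zsmul, Pi.smul_apply]
      by_cases hk : k ∈ F'.J
      · rw [hx k hk, zero_smul]
      · rw [g.map_notMem k hk j hj, smul_zero]
    exact key _ fun k hk => f.map_notMem i hi k hk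
  map_virtual := by
    obtain ⟨s, hs⟩ := f.map_virtual
    obtain ⟨t, ht⟩ := g.map_virtual
    exact ⟨t ∘ s, fun i => by rw [AddMonoidHom.comp_apply, hs, ht]; rfl⟩

/-- The category of calibrated quantum fans in `ℝ^d` with calibration defined on `ℤ^n`. -/
instance : Category (CalibratedQuantumFan d n) where
  Hom := Hom
  id := Hom.id
  comp := Hom.comp
  id_comp _ := rfl
  comp_id _ := rfl
  assoc _ _ _ := rfl

/-- The length `|J|` is maximal, that is, equal to `n - p` where `p` is the number
of `1`-cones. -/
def IsMaximal (F : CalibratedQuantumFan d n) : Prop :=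
  F.J.card = n - F.I.card

/-- The combinatorial type of the fan is equivalent to `D`, up to a numbering of the `1`-cones. -/
def HasCombType {p : ℕ} (F : CalibratedQuantumFan d n) (D : Set (Finset (Fin p))) : Prop :=
  ∃ e : Fin p ≃ F.I, ∀ K : Finset (Fin p), K ∈ D ↔ K.map e.toEmbedding ∈ F.fan.comb

end CalibratedQuantumFan

/-! ## Combinatorial types and realizable calibrations -/

/-- `D` is the combinatorial type of a simplicial quantum fan in `ℝ^d` with `p` `1`-cones. -/
def IsCombinatorialType (d : ℕ) {p : ℕ} (D : Set (Finset (Fin p))) : Prop :=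
  ∃ F : FanData d (Fin p), F.IsQuantumFan ∧ F.IsSimplicial ∧ F.comb = D

/-- `D'` is obtained from `D` by renumbering the `1`-cones, in such a way that `{1, …, d} ∈ D'`. -/
def IsAdaptedNumbering (d : ℕ) {p : ℕ} (D D' : Set (Finset (Fin p))) : Prop :=
  (∃ s : Equiv.Perm (Fin p), ∀ K : Finset (Fin p), K ∈ D ↔ K.map s.toEmbedding ∈ D') ∧
    (Finset.univ.filter fun i : Fin p => i.val < d) ∈ D'

/-- A family `v_1, …, v_p` of vectors of `ℝ^d` is `D`-realizable if there is a simplicial fan in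
`Γ = ℤ v_1 + … + ℤ v_p` with `1`-cone generators `v_1, …, v_p` and combinatorial type `D`. -/
def IsRealizable {d p : ℕ} (D : Set (Finset (Fin p))) (v : Fin p → Vec d) : Prop :=
  ∃ F : FanData d (Fin p), F.Γ = AddSubgroup.closure (Set.range v) ∧ F.gen = v ∧
    F.IsQuantumFan ∧ F.IsSimplicial ∧ F.comb = D

/-- The space `(ℝ^d)^(n-d)` of homomorphisms `ħ : ℤ^(n-d) → ℝ^d`. -/
abbrev CalibrationSpace (d n : ℕ) : Type := Fin (n - d) → Vec d

/-- The images `e_1, …, e_d, ħ_1, …, ħ_(n-d)` of the basis vectors under the standard calibration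
`h(x, y) = x + ħ(y)`. -/
def stdVec {d n : ℕ} (ħ : CalibrationSpace d n) (i : Fin n) : Vec d :=
  if hi : i.val < d then EuclideanSpace.single ⟨i.val, hi⟩ 1
  else ħ ⟨i.val - d, by omega⟩

/-- The standard calibration `h : ℤ^n → ℝ^d` determined by `ħ`. -/
def stdCalibration {d n : ℕ} (ħ : CalibrationSpace d n) : (Fin n → ℤ) →+ Vec d where
  toFun x := ∑ i, x i • stdVec ħ i
  map_zero' := by simp
  map_add' x y := by simp [add_smul, Finset.sum_add_distrib]

theorem stdCalibration_single {d n : ℕ} (ħ : CalibrationSpace d n) (i : Fin n) :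
    stdCalibration ħ (Pi.single i 1) = stdVec ħ i := by
  simp [stdCalibration, Pi.single_apply]

/-- The set `U` of the `ħ` such that the first `p` vectors of the standard calibration are
`D`-realizable. -/
def realizableSet {d n p : ℕ} (hpn : p ≤ n) (D : Set (Finset (Fin p))) :
    Set (CalibrationSpace d n) :=
  {ħ | IsRealizable D fun i : Fin p => stdVec ħ (Fin.castLE hpn i)}

/-- The cones generated by the `v_i`, `i ∈ K`, for `K ∈ D`. -/
def conesOf {d p : ℕ} (D : Set (Finset (Fin p))) (v : Fin p → Vec d) :
    Set (PointedCone ℝ (Vec d)) :=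
  {σ | ∃ K ∈ D, σ = PointedCone.hull ℝ (v '' (K : Set (Fin p)))}

/-- The standard calibrated quantum fan of maximal length defined by `ħ ∈ U`: its generators are
indexed by `{1, …, p}` and its virtual generators by `{p+1, …, n}`. -/
def stdFan {d n p : ℕ} (hpn : p ≤ n) (D : Set (Finset (Fin p)))
    (ħ : realizableSet (d := d) hpn D) : CalibratedQuantumFan d n where
  cones := conesOf D fun i : Fin p => stdVec ħ.1 (Fin.castLE hpn i)
  h := stdCalibration ħ.1
  I := Finset.univ.filter fun i => i.val < p
  J := Finset.univ.filter fun i => p ≤ i.val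
  isQuantumFan := by
    obtain ⟨⟨Γ, Δ, v⟩, hΓ, hv, hF, hS, hD⟩ := ħ.2
    have hcones := hF.cones_eq hS
    rw [hD] at hcones
    dsimp only at hΓ hv hcones
    subst hΓ
    have hgen : ∀ i : {i : Fin n // i ∈ Finset.univ.filter fun i : Fin n => i.val < p},
        stdCalibration ħ.1 (Pi.single i.1 1) = v ⟨i.1.val, (Finset.mem_filter.1 i.2).2⟩ := by
      intro i
      rw [stdCalibration_single, hv]
      rfl
    have hgen' : ∀ j : Fin p, v j = stdCalibration ħ.1 (Pi.single (Fin.castLE hpn j) 1) := by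
      intro j
      rw [stdCalibration_single, hv]
    have hle : AddSubgroup.closure (Set.range v) ≤ (stdCalibration ħ.1).range := by
      rw [AddSubgroup.closure_le]
      rintro _ ⟨j, rfl⟩
      exact ⟨_, (hgen' j).symm⟩
    have hc : (conesOf D fun i : Fin p => stdVec ħ.1 (Fin.castLE hpn i)) = Δ := by
      rw [hcones, ← hv]; rfl
    rw [hc, ← hv] at *
    exact
      { fg := by
          have : AddGroup.FG (stdCalibration ħ.1).range := inferInstance
          exact (AddGroup.fg_iff_addSubgroup_fg _).1 this
        span_eq_top := top_le_iff.1 (hF.span_eq_top ▸ Submodule.span_mono hle)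
        polyhedral := fun σ hσ => by
          obtain ⟨s, h1, h2, h3⟩ := hF.polyhedral σ hσ
          exact ⟨s, h1, h2.trans hle, h3⟩
        strongly_convex := hF.strongly_convex
        zero_mem := hF.zero_mem
        face_mem := hF.face_mem
        inter_face := hF.inter_face
        gen_mem := fun i => ⟨_, rfl⟩
        gen_ne_zero := fun i => by
          change stdCalibration ħ.1 (Pi.single i.1 1) ≠ 0
          rw [hgen i]
          exact hF.gen_ne_zero _
        ray_mem := fun i => by
          change PointedCone.hull ℝ {stdCalibration ħ.1 (Pi.single i.1 1)} ∈ Δ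
          rw [hgen i]
          exact hF.ray_mem _
        ray_injective := fun i j hij => by
          change PointedCone.hull ℝ {stdCalibration ħ.1 (Pi.single i.1 1)} =
            PointedCone.hull ℝ {stdCalibration ħ.1 (Pi.single j.1 1)} at hij
          rw [hgen i, hgen j] at hij
          have h1 := hF.ray_injective hij
          exact Subtype.ext (Fin.ext (congrArg (fun k : Fin p => k.val) h1))
        ray_surjective := fun σ hσ h1 => by
          obtain ⟨j, hj⟩ := hF.ray_surjective σ hσ h1
          refine ⟨⟨Fin.castLE hpn j, by simp⟩, ?_⟩
          change σ = PointedCone.hull ℝ {stdCalibration ħ.1 (Pi.single (Fin.castLE hpn j) 1)}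
          rw [← hgen' j]
          exact hj }
  span_eq_top := by
    obtain ⟨F, hΓ, hv, hF, -, -⟩ := ħ.2
    have h1 := hF.span_eq_top
    rw [hΓ] at h1
    rw [← top_le_iff, ← h1]
    refine Submodule.span_le.2 fun x hx => ?_
    induction hx using AddSubgroup.closure_induction with
    | mem x hx =>
      obtain ⟨j, rfl⟩ := hx
      refine Submodule.subset_span ⟨Fin.castLE hpn j, by simp, ?_⟩
      rw [stdCalibration_single]
    | zero => exact zero_mem _
    | add x y _ _ hx hy => exact add_mem hx hy
    | neg x _ hx => exact neg_mem hx
  disjoint := by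
    rw [Finset.disjoint_left]
    intro i hi hi'
    simp at hi hi'
    omega

/-! ## The moduli space -/

/-- Calibrated quantum fans `(Δ, h)`, with `h : ℤ^n → ℝ^d`, that are simplicial, of maximal length
and of combinatorial type equivalent to `D`. -/
def IsOfType {d n p : ℕ} (D : Set (Finset (Fin p))) (F : CalibratedQuantumFan d n) : Prop :=
  F.fan.IsSimplicial ∧ F.IsMaximal ∧ F.HasCombType D

/-- The moduli space: isomorphism classes of calibrated quantum fans of maximal length and of
combinatorial type equivalent to `D`. The argument `hpn` only serves to define its topology. -/
def ModuliSpace (d : ℕ) {n p : ℕ} (_hpn : p ≤ n) (D : Set (Finset (Fin p))) : Type :=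
  Quotient ((isIsomorphicSetoid (CalibratedQuantumFan d n)).comap
    (Subtype.val : {F : CalibratedQuantumFan d n // IsOfType D F} → _))

theorem stdFan_isOfType {d n p : ℕ} (hpn : p ≤ n) {D D' : Set (Finset (Fin p))}
    (hD : IsAdaptedNumbering d D D') (ħ : realizableSet (d := d) hpn D') :
    IsOfType D (stdFan hpn D' ħ) := by
  obtain ⟨F, hΓ, hv, hF, hS, hcomb⟩ := ħ.2
  have hcones := hF.cones_eq hS
  rw [hcomb, hv] at hcones
  refine ⟨?_, ?_, ?_⟩
  · intro σ hσ
    refine hS σ ?_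
    rw [hcones]
    exact hσ
  · have h1 : (stdFan hpn D' ħ).I.card = p := by
      change (Finset.univ.filter fun i : Fin n => i.val < p).card = p
      rw [Fin.card_filter_val_lt, min_eq_right hpn]
    have h2 : (stdFan hpn D' ħ).J = (stdFan hpn D' ħ).Iᶜ := by
      ext i
      simp [stdFan]
    rw [CalibratedQuantumFan.IsMaximal, h2, Finset.card_compl, Fintype.card_fin]
  · obtain ⟨⟨s, hs⟩, -⟩ := hD
    let e : Fin p ≃ (stdFan hpn D' ħ).I :=
      { toFun := fun j => ⟨Fin.castLE hpn j, by simp [stdFan]⟩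
        invFun := fun i => ⟨i.1.val, (Finset.mem_filter.1 i.2).2⟩
        left_inv := fun j => rfl
        right_inv := fun i => rfl }
    refine ⟨s.trans e, fun K => ?_⟩
    have himg : (stdFan hpn D' ħ).fan.gen '' ((K.map (s.trans e).toEmbedding : Finset _) : Set _)
        = F.gen '' ((K.map s.toEmbedding : Finset _) : Set _) := by
      rw [Finset.coe_map, Finset.coe_map, Set.image_image, Set.image_image]
      refine Set.image_congr fun j _ => ?_
      rw [hv]
      exact stdCalibration_single _ _
    have hmem : K.map s.toEmbedding ∈ F.comb ↔ K.map s.toEmbedding ∈ D' := by rw [hcomb]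
    refine (hs K).trans (hmem.symm.trans ?_)
    change PointedCone.hull ℝ _ ∈ F.cones ↔ PointedCone.hull ℝ _ ∈ (stdFan hpn D' ħ).cones
    rw [himg, hcones]
    rfl

/-- The map that sends `ħ ∈ U` to the class of its standard calibrated fan. -/
def toModuli {d n p : ℕ} (hpn : p ≤ n) {D D' : Set (Finset (Fin p))}
    (hD : IsAdaptedNumbering d D D') (ħ : realizableSet (d := d) hpn D') :
    ModuliSpace d hpn D :=
  Quotient.mk _ ⟨stdFan hpn D' ħ, stdFan_isOfType hpn hD ħ⟩

/-- The quotient topology: the finest topology for which the maps from the sets `U` of standard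
calibrations to the moduli space are continuous. -/
instance {d n p : ℕ} (hpn : p ≤ n) (D : Set (Finset (Fin p))) :
    TopologicalSpace (ModuliSpace d hpn D) :=
  ⨆ D' : {D' // IsAdaptedNumbering d D D'},
    TopologicalSpace.coinduced (toModuli (d := d) hpn D'.2) inferInstance

/-- The permutation of `{1, …, n}` given by `s` on `{1, …, p}` and by `t` on `{p+1, …, n}`. -/
def blockPerm {n p : ℕ} (hpn : p ≤ n) (s : Equiv.Perm (Fin p)) (t : Equiv.Perm (Fin (n - p))) :
    Equiv.Perm (Fin n) :=
  (finSumFinEquiv.trans (finCongr (Nat.add_sub_of_le hpn))).permCongr (Equiv.sumCongr s t)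

/-- The automorphism `H` of `ℤ^n` that sends `e_(s(i))` to `e_i` for `i ≤ p`, and permutes the last
`n - p` basis vectors through the inverse of `t`. -/
def blockH {n p : ℕ} (hpn : p ≤ n) (s : Equiv.Perm (Fin p)) (t : Equiv.Perm (Fin (n - p))) :
    (Fin n → ℤ) ≃+ (Fin n → ℤ) where
  toFun x i := x (blockPerm hpn s t i)
  invFun x i := x ((blockPerm hpn s t).symm i)
  left_inv x := by ext; simp
  right_inv x := by ext; simp
  map_add' _ _ := rfl

/-- The relation `h' = L h H⁻¹`, where `(s, t) ∈ 𝔖_p × 𝔖_(n-p)`, the permutation `s` preserves `D`,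
`L` is the inverse of the matrix `(v_(s(1)), …, v_(s(d)))` and `H` is `diag(s, t)⁻¹`. -/
def IsTransition {d n p : ℕ} (hpn : p ≤ n) (D : Set (Finset (Fin p)))
    (s : Equiv.Perm (Fin p)) (t : Equiv.Perm (Fin (n - p))) (ħ ħ' : CalibrationSpace d n) : Prop :=
  (∀ K : Finset (Fin p), K ∈ D ↔ K.map s.toEmbedding ∈ D) ∧
  ∃ L : Vec d ≃ₗ[ℝ] Vec d,
    (∀ (i : Fin p) (hi : i.val < d),
      L (stdVec ħ (Fin.castLE hpn (s i))) = EuclideanSpace.single ⟨i.val, hi⟩ 1) ∧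
    ∀ x, stdCalibration ħ' x = L (stdCalibration ħ ((blockH hpn s t).symm x))

/-! ## Orbifolds -/

/-- A structure of real orbifold on a topological space `X`, modelled on a finite-dimensional real
vector space `V`: a proper étale Lie groupoid with finite isotropy groups, whose orbit space is
identified with `X`. The dimension of the orbifold is the dimension of `V`. Since `src` and `tgt`
are local diffeomorphisms, the composition is smooth as soon as it is continuous. -/
structure RealOrbifoldStructure (V : Type) [NormedAddCommGroup V] [NormedSpace ℝ V]
    (X : Type) [TopologicalSpace X] where
  Obj : Type
  Arr : Type
  [topObj : TopologicalSpace Obj]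
  [topArr : TopologicalSpace Arr]
  [chartedObj : ChartedSpace V Obj]
  [chartedArr : ChartedSpace V Arr]
  [manifoldObj : IsManifold 𝓘(ℝ, V) ∞ Obj]
  [manifoldArr : IsManifold 𝓘(ℝ, V) ∞ Arr]
  [t2Obj : T2Space Obj]
  [t2Arr : T2Space Arr]
  [secondObj : SecondCountableTopology Obj]
  [secondArr : SecondCountableTopology Arr]
  src : Arr → Obj
  tgt : Arr → Obj
  one : Obj → Arr
  inv : Arr → Arr
  comp : ∀ g g' : Arr, tgt g = src g' → Arr
  src_one : ∀ x, src (one x) = x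
  tgt_one : ∀ x, tgt (one x) = x
  src_inv : ∀ g, src (inv g) = tgt g
  tgt_inv : ∀ g, tgt (inv g) = src g
  src_comp : ∀ g g' h, src (comp g g' h) = src g
  tgt_comp : ∀ g g' h, tgt (comp g g' h) = tgt g'
  one_comp : ∀ g, comp (one (src g)) g (tgt_one _) = g
  comp_one : ∀ g, comp g (one (tgt g)) (src_one _).symm = g
  comp_inv : ∀ g, comp g (inv g) (src_inv g).symm = one (src g)
  inv_comp : ∀ g, comp (inv g) g (tgt_inv g) = one (tgt g)
  assoc : ∀ g g' g'' (h : tgt g = src g') (h' : tgt g' = src g''),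
    comp (comp g g' h) g'' ((tgt_comp g g' h).trans h') =
      comp g (comp g' g'' h') (h.trans (src_comp g' g'' h').symm)
  src_localDiffeo : IsLocalDiffeomorph 𝓘(ℝ, V) 𝓘(ℝ, V) ∞ src
  tgt_localDiffeo : IsLocalDiffeomorph 𝓘(ℝ, V) 𝓘(ℝ, V) ∞ tgt
  one_smooth : ContMDiff 𝓘(ℝ, V) 𝓘(ℝ, V) ∞ one
  inv_smooth : ContMDiff 𝓘(ℝ, V) 𝓘(ℝ, V) ∞ inv
  comp_continuous : Continuous fun q : {q : Arr × Arr // tgt q.1 = src q.2} =>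
    comp q.1.1 q.1.2 q.2
  proper : IsProperMap fun g => (src g, tgt g)
  finite_isotropy : ∀ x, {g | src g = x ∧ tgt g = x}.Finite
  proj : Obj → X
  proj_quotientMap : IsQuotientMap proj
  proj_eq_iff : ∀ x y, proj x = proj y ↔ ∃ g, src g = x ∧ tgt g = y

attribute [instance] RealOrbifoldStructure.topObj RealOrbifoldStructure.topArr
  RealOrbifoldStructure.chartedObj RealOrbifoldStructure.chartedArr
  RealOrbifoldStructure.manifoldObj RealOrbifoldStructure.manifoldArr

end

noncomputable section

/-! ## Cones over the faces of a simplicial complex -/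

section Cones

variable {ι E E' : Type*} [Fintype ι] [AddCommGroup E] [Module ℝ E] [AddCommGroup E'] [Module ℝ E']

/-! Realizability depends only on the vectors. A family `v` is `D`-realizable exactly when the map
induced by `v` from the union of the coordinate cones of `D` to `ℝ^d` is injective
(`isRealizable_iff`). A failure of injectivity is a nonzero linear relation `c` between the `v i`
whose positive part is supported on one member of `D` and whose negative part on another. Such
relations may be scaled to the unit sphere, where they range over a compact set independent of `v`;
hence `U` is open (`isOpen_setOf_isConeInjective`).

For maximal length, `J` is the complement of `I`, so an isomorphism and its inverse have nonnegative
integer matrices. They are therefore permutation matrices (`exists_perm_of_nonneg`) that preserve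
`I` and `J`. Between standard fans such a permutation is a pair `(s, t)`, and `L` is forced by its
values on `d` independent generators. Thus two standard fans are isomorphic exactly when some `(s,
t)` carries one to the other (`exists_isRelabelling`, `toModuli_eq_iff`). Conversely, any fan of the
given type becomes standard once its generators are renumbered and its first `d` vectors are moved
to the standard basis (`toModuli_surjective`). A change of numbering is a continuous map between the
sets `U` over the moduli space, so all of them coinduce the same topology
(`isQuotientMap_toModuli`).

The pairs `(s, t)` for which `s` preserves `D` form a finite group, which acts on `U` from the right
by `renumber`. The action is smooth because matrix inversion is smooth. The orbifold structure is
its action groupoid: finiteness of the group gives properness and finite isotropy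
(`SmoothRightAction.orbifold`). -/

theorem mem_hull_image_iff {K : Set ι} {v : ι → E} {x : E} :
    x ∈ PointedCone.hull ℝ (v '' K) ↔
      ∃ a : ι → ℝ, (∀ i, 0 ≤ a i) ∧ (∀ i, i ∉ K → a i = 0) ∧ x = ∑ i, a i • v i := by
  classical
  constructor
  · intro hx
    induction hx using Submodule.span_induction with
    | mem x hx =>
      obtain ⟨j, hj, rfl⟩ := hx
      refine ⟨Pi.single j 1, fun i => ?_, fun i hi => ?_, ?_⟩
      · by_cases h : i = j <;> simp [h]
      · have : i ≠ j := fun h => hi (h ▸ hj)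
        simp [this]
      · simp [Pi.single_apply]
    | zero => exact ⟨0, by simp, by simp, by simp⟩
    | add x y _ _ hx hy =>
      obtain ⟨a, ha, ha', rfl⟩ := hx
      obtain ⟨b, hb, hb', rfl⟩ := hy
      exact ⟨a + b, fun i => add_nonneg (ha i) (hb i), fun i hi => by simp [ha' i hi, hb' i hi],
        by simp [add_smul, Finset.sum_add_distrib]⟩
    | smul r x _ hx =>
      obtain ⟨a, ha, ha', rfl⟩ := hx
      refine ⟨fun i => (r : ℝ) * a i, fun i => mul_nonneg r.2 (ha i),
        fun i hi => by simp [ha' i hi], ?_⟩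
      change (r : ℝ) • (∑ i, a i • v i) = _
      simp [Finset.smul_sum, mul_smul]
  · rintro ⟨a, ha, ha', rfl⟩
    refine sum_mem fun i _ => ?_
    by_cases hi : i ∈ K
    · exact PointedCone.smul_mem _ (ha i) (Submodule.subset_span ⟨i, hi, rfl⟩)
    · rw [ha' i hi, zero_smul]; exact zero_mem _

theorem mem_hull_singleton_iff {v x : E} :
    x ∈ PointedCone.hull ℝ {v} ↔ ∃ t : ℝ, 0 ≤ t ∧ x = t • v := by
  constructor
  · intro h
    obtain ⟨t, rfl⟩ := Submodule.mem_span_singleton.1 h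
    exact ⟨t, t.2, rfl⟩
  · rintro ⟨t, ht, rfl⟩
    exact PointedCone.smul_mem _ ht (Submodule.subset_span rfl)

theorem hull_singleton_eq_of_smul {v x : E} {t : ℝ} (ht : 0 < t) (h : x = t • v) :
    PointedCone.hull ℝ {x} = PointedCone.hull ℝ {v} := by
  apply le_antisymm <;> refine Submodule.span_le.2 (Set.singleton_subset_iff.2 ?_)
  · exact mem_hull_singleton_iff.2 ⟨t, ht.le, h⟩
  · refine mem_hull_singleton_iff.2 ⟨t⁻¹, (inv_pos.2 ht).le, ?_⟩
    rw [h, inv_smul_smul₀ ht.ne']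

theorem map_hull (L : E →ₗ[ℝ] E') (s : Set E) :
    (PointedCone.hull ℝ s).map L = PointedCone.hull ℝ (L '' s) :=
  Submodule.map_span _ _

/-- The cones generated by the `v_i`, `i ∈ K`, for `K ∈ D`, are simplicial, and any two of them
meet exactly along the cone of their common generators: the map from the union of the coordinate
cones of `D` induced by `v` is injective. -/
def IsConeInjective (D : Set (Finset ι)) (v : ι → E) : Prop :=
  ∀ K ∈ D, ∀ K' ∈ D, ∀ c : ι → ℝ, (∀ i, i ∉ K → c i ≤ 0) → (∀ i, i ∉ K' → 0 ≤ c i) →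
    ∑ i, c i • v i = 0 → c = 0

namespace IsConeInjective

variable {D : Set (Finset ι)} {v : ι → E}

/-- Apply the definition to `c = a - b`, which is `-b` off `K` and `a` off `K'`. -/
theorem eq_of_sum_eq (h : IsConeInjective D v) {K K' : Finset ι} (hK : K ∈ D) (hK' : K' ∈ D)
    {a b : ι → ℝ} (ha : ∀ i, 0 ≤ a i) (ha' : ∀ i, i ∉ K → a i = 0) (hb : ∀ i, 0 ≤ b i)
    (hb' : ∀ i, i ∉ K' → b i = 0) (hab : ∑ i, a i • v i = ∑ i, b i • v i) : a = b := by
  refine sub_eq_zero.1 (h K hK K' hK' (a - b) (fun i hi => ?_) (fun i hi => ?_) ?_)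
  · simp [ha' i hi, hb i]
  · simp [hb' i hi, ha i]
  · simp [sub_smul, hab]

/-- For `K' = K` the two sign conditions together say only that `c` vanishes off `K`. -/
theorem linearIndepOn (h : IsConeInjective D v) {K : Finset ι} (hK : K ∈ D) :
    LinearIndepOn ℝ v (K : Set ι) := by
  classical
  rw [linearIndepOn_finset_iff]
  intro f hf i hi
  have := h K hK K hK (fun i => if i ∈ K then f i else 0) (fun i hi => by simp [hi])
    (fun i hi => by simp [hi]) ?_
  · simpa [hi] using congrFun this i
  · simpa [ite_smul, Finset.sum_ite_mem] using hf

theorem comp_injective (h : IsConeInjective D v) (L : E →ₗ[ℝ] E') (hL : Function.Injective L) :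
    IsConeInjective D (L ∘ v) := by
  intro K hK K' hK' c h1 h2 h3
  refine h K hK K' hK' c h1 h2 (hL ?_)
  simpa using h3

theorem reindex {ι' : Type*} [Fintype ι'] {D' : Set (Finset ι')} {v : ι' → E} (e : ι ≃ ι')
    (h : IsConeInjective D' v) (hD : ∀ K ∈ D, K.map e.toEmbedding ∈ D') :
    IsConeInjective D (v ∘ e) := by
  intro K hK K' hK' c h1 h2 h3
  have := h _ (hD K hK) _ (hD K' hK') (c ∘ e.symm) (fun i hi => h1 _ fun hi' => hi ?_)
    (fun i hi => h2 _ fun hi' => hi ?_) ?_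
  · ext i
    simpa using congrFun this (e i)
  · simpa using Finset.mem_map_of_mem e.toEmbedding hi'
  · simpa using Finset.mem_map_of_mem e.toEmbedding hi'
  · rw [← h3, ← e.sum_comp]
    simp

/-- The generators that lie in a cone of the family are generators of that cone. -/
theorem mem_of_mem_hull (h : IsConeInjective D v) (hs : ∀ i, {i} ∈ D) {K : Finset ι} (hK : K ∈ D)
    {i : ι} (hi : v i ∈ PointedCone.hull ℝ (v '' (K : Set ι))) : i ∈ K := by
  classical
  obtain ⟨a, ha, ha', hia⟩ := mem_hull_image_iff.1 hi
  have := h.eq_of_sum_eq (hs i) hK (a := Pi.single i 1) (b := a)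
    (fun j => by by_cases hj : j = i <;> simp [hj])
    (fun j hj => by simpa [Pi.single_apply] using hj) ha ha' (by simpa [Pi.single_apply] using hia)
  by_contra hiK
  simpa [ha' i (by simpa using hiK)] using congrFun this i

/-- Coefficients over `K` are unique. If those of `x + y` vanish off `L`, so do those of `x`, since
nonnegative numbers with zero sum are zero. -/
theorem isFaceOf (h : IsConeInjective D v) {K : Finset ι} (hK : K ∈ D) {L : Set ι}
    (hL : L ⊆ K) : (PointedCone.hull ℝ (v '' L)).IsFaceOf
      (PointedCone.hull ℝ (v '' (K : Set ι))) := by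
  refine PointedCone.IsFaceOf.of_mem_of_add_mem_left
    (Submodule.span_mono (Set.image_mono hL)) fun {x y} hx hy hxy => ?_
  obtain ⟨a, ha, ha', rfl⟩ := mem_hull_image_iff.1 hx
  obtain ⟨b, hb, hb', rfl⟩ := mem_hull_image_iff.1 hy
  obtain ⟨c, hc, hc', hcc⟩ := mem_hull_image_iff.1 hxy
  have := h.eq_of_sum_eq hK hK (a := a + b) (b := c) (fun i => add_nonneg (ha i) (hb i))
    (fun i hi => by simp [ha' i hi, hb' i hi]) hc
    (fun i hi => hc' i fun hi' => hi (hL hi')) (by rw [← hcc]; simp [add_smul,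
      Finset.sum_add_distrib])
  refine mem_hull_image_iff.2 ⟨a, ha, fun i hi => ?_, rfl⟩
  have h1 : a i + b i = 0 := by rw [← hc' i hi, ← this]; rfl
  linarith [ha i, hb i]

/-- No injectivity is needed here: when a nonnegative combination lies in a face, each generator
with positive coefficient lies in the face. -/
theorem eq_hull_of_isFaceOf {K : Finset ι} {τ : PointedCone ℝ E}
    (hτ : τ.IsFaceOf (PointedCone.hull ℝ (v '' (K : Set ι)))) :
    τ = PointedCone.hull ℝ (v '' {i | i ∈ K ∧ v i ∈ τ}) := by
  apply le_antisymm
  · intro x hx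
    obtain ⟨a, ha, ha', rfl⟩ := mem_hull_image_iff.1 (hτ.le hx)
    refine mem_hull_image_iff.2 ⟨a, ha, fun i hi => ?_, rfl⟩
    by_cases hiK : i ∈ K
    · by_contra h0
      refine hi ⟨hiK, ?_⟩
      classical
      have hpos : 0 < a i := lt_of_le_of_ne (ha i) (Ne.symm h0)
      refine hτ.mem_of_smul_add_mem (y := ∑ j ∈ Finset.univ.filter (· ≠ i), a j • v j)
        (Submodule.subset_span ⟨i, hiK, rfl⟩) (sum_mem fun j _ => ?_) hpos ?_
      · by_cases hj : j ∈ K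
        · exact PointedCone.smul_mem _ (ha j) (Submodule.subset_span ⟨j, hj, rfl⟩)
        · rw [ha' j hj, zero_smul]; exact zero_mem _
      · rwa [Finset.filter_ne', Finset.add_sum_erase _ (fun j => a j • v j) (Finset.mem_univ i)]
    · exact ha' i hiK
  · refine Submodule.span_le.2 ?_
    rintro _ ⟨i, hi, rfl⟩
    exact hi.2

theorem inf_hull (h : IsConeInjective D v) {K K' : Finset ι} (hK : K ∈ D) (hK' : K' ∈ D) :
    PointedCone.hull ℝ (v '' (K : Set ι)) ⊓ PointedCone.hull ℝ (v '' (K' : Set ι)) =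
      PointedCone.hull ℝ (v '' ((K : Set ι) ∩ K')) := by
  apply le_antisymm
  · rintro x ⟨hx, hx'⟩
    obtain ⟨a, ha, ha', rfl⟩ := mem_hull_image_iff.1 hx
    obtain ⟨b, hb, hb', hab⟩ := mem_hull_image_iff.1 hx'
    have := h.eq_of_sum_eq hK hK' ha ha' hb hb' hab
    subst this
    refine mem_hull_image_iff.2 ⟨a, ha, fun i hi => ?_, rfl⟩
    by_cases hiK : i ∈ K
    · exact hb' i fun hi' => hi ⟨hiK, hi'⟩
    · exact ha' i hiK
  · exact le_inf (Submodule.span_mono (Set.image_mono Set.inter_subset_left))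
      (Submodule.span_mono (Set.image_mono Set.inter_subset_right))

end IsConeInjective

/-- Cone injectivity is an open condition on the family of generators. -/
theorem isOpen_setOf_isConeInjective {E : Type*} [NormedAddCommGroup E] [NormedSpace ℝ E]
    (D : Set (Finset ι)) : IsOpen {v : ι → E | IsConeInjective D v} := by
  -- The conditions on `c` are invariant under positive scaling, so `v` is bad exactly when it
  -- admits a relation with coefficients in `S`. As `S` is compact, the projection of the closed set
  -- of such pairs to the `v` factor is closed.
  let S : Set (ι → ℝ) := {c | c ∈ Metric.sphere 0 1 ∧ ∃ K ∈ D, ∃ K' ∈ D,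
    (∀ i, i ∉ K → c i ≤ 0) ∧ ∀ i, i ∉ K' → 0 ≤ c i}
  have hS : IsCompact S := by
    refine (isCompact_sphere (0 : ι → ℝ) 1).of_isClosed_subset ?_ fun c hc => hc.1
    have : S = Metric.sphere 0 1 ∩ ⋃ K ∈ D, ⋃ K' ∈ D,
        {c : ι → ℝ | (∀ i, i ∉ K → c i ≤ 0) ∧ ∀ i, i ∉ K' → 0 ≤ c i} := by
      ext c; simp only [S, Set.mem_ofPred_eq, Set.mem_inter_iff, Set.mem_iUnion, exists_prop]
    rw [this]
    refine Metric.isClosed_sphere.inter ?_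
    refine (Set.toFinite D).isClosed_biUnion fun K _ => ?_
    refine (Set.toFinite D).isClosed_biUnion fun K' _ => ?_
    simp only [Set.ofPred_and, Set.ofPred_forall]
    refine IsClosed.inter ?_ ?_ <;> refine isClosed_iInter fun i => isClosed_iInter fun _ => ?_
    · exact isClosed_le (continuous_apply i) continuous_const
    · exact isClosed_le continuous_const (continuous_apply i)
  have hC : IsClosed {q : S × (ι → E) | ∑ i, q.1.1 i • q.2 i = 0} :=
    isClosed_eq (continuous_finsetSum _ fun i _ => Continuous.smul
      ((continuous_apply i).comp (continuous_subtype_val.comp continuous_fst))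
      ((continuous_apply i).comp continuous_snd)) continuous_const
  have : CompactSpace S := isCompact_iff_compactSpace.1 hS
  have hcl := (isClosedMap_snd_of_compactSpace (X := S) (Y := ι → E)) _ hC
  convert hcl.isOpen_compl using 1
  ext v
  simp only [Set.mem_ofPred_eq, Set.mem_compl_iff, Set.mem_image, Prod.exists, exists_eq_right,
    Subtype.exists, exists_prop, not_exists, not_and]
  constructor
  · rintro h c ⟨hc1, K, hK, K', hK', h1, h2⟩ h3
    rw [h K hK K' hK' c h1 h2 h3] at hc1
    simp at hc1
  · intro h K hK K' hK' c h1 h2 h3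
    by_contra hc
    have hn : 0 < ‖c‖ := norm_pos_iff.2 hc
    refine h (‖c‖⁻¹ • c) ⟨?_, K, hK, K', hK', fun i hi => ?_, fun i hi => ?_⟩ ?_
    · simp [norm_smul, hn.ne']
    · exact mul_nonpos_of_nonneg_of_nonpos (inv_pos.2 hn).le (h1 i hi)
    · exact mul_nonneg (inv_pos.2 hn).le (h2 i hi)
    · simp only [Pi.smul_apply, smul_assoc, ← Finset.smul_sum, h3, smul_zero]

end Cones

/-! ## Realizable families of generators -/

/-- The properties of an abstract simplicial complex on the vertex set `ι`. -/
structure IsVertexComplex {ι : Type*} (D : Set (Finset ι)) : Prop where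
  empty_mem : ∅ ∈ D
  singleton_mem : ∀ i, {i} ∈ D
  mem_of_subset : ∀ K ∈ D, ∀ L, L ⊆ K → L ∈ D

theorem IsVertexComplex.of_perm {ι : Type*} {D D' : Set (Finset ι)} (hD : IsVertexComplex D)
    (s : Equiv.Perm ι) (hs : ∀ K : Finset ι, K ∈ D ↔ K.map s.toEmbedding ∈ D') :
    IsVertexComplex D' := by
  have hs' : ∀ K : Finset ι, K ∈ D' ↔ K.map s.symm.toEmbedding ∈ D := by
    intro K
    rw [hs, Finset.map_map]
    simp
  refine ⟨?_, fun i => ?_, fun K hK L hLK => ?_⟩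
  · simpa [hs'] using hD.empty_mem
  · simpa [hs'] using hD.singleton_mem _
  · rw [hs'] at hK ⊢
    exact hD.mem_of_subset _ hK _ (Finset.map_subset_map.2 hLK)

namespace FanData

variable {d : ℕ} {ι : Type} {F : FanData d ι}

theorem IsQuantumFan.ray_isFaceOf (hF : F.IsQuantumFan) {σ : PointedCone ℝ (Vec d)}
    (hσ : σ ∈ F.cones) {i : ι} (hi : F.gen i ∈ σ) :
    (PointedCone.hull ℝ {F.gen i}).IsFaceOf σ := by
  have h := (hF.inter_face _ (hF.ray_mem i) σ hσ).2
  rwa [inf_eq_left.2 (Submodule.span_le.2 (Set.singleton_subset_iff.2 hi))] at h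

/-- A generator of a `1`-cone contained in a finitely generated cone of the fan is proportional to
one of the generators of this cone. -/
theorem IsQuantumFan.exists_eq_smul (hF : F.IsQuantumFan) {κ : Type} [Fintype κ] (w : κ → Vec d)
    {K : Finset κ} (hK : PointedCone.hull ℝ (w '' (K : Set κ)) ∈ F.cones) {i : ι}
    (hi : F.gen i ∈ PointedCone.hull ℝ (w '' (K : Set κ))) (hw : ∀ k ∈ K, w k ≠ 0) :
    ∃ k ∈ K, ∃ t : ℝ, 0 < t ∧ w k = t • F.gen i := by
  -- The ray is a face, hence generated by the `w k` that it contains. If there were none it would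
  -- be the zero cone.
  have h := IsConeInjective.eq_hull_of_isFaceOf (hF.ray_isFaceOf hK hi)
  by_cases hne : ∃ k ∈ K, w k ∈ PointedCone.hull ℝ {F.gen i}
  · obtain ⟨k, hk, hki⟩ := hne
    obtain ⟨t, ht, hkt⟩ := mem_hull_singleton_iff.1 hki
    refine ⟨k, hk, t, lt_of_le_of_ne ht fun h0 => hw k hk ?_, hkt⟩
    rw [hkt, ← h0, zero_smul]
  · have hemp : {k | k ∈ K ∧ w k ∈ PointedCone.hull ℝ {F.gen i}} = ∅ := by
      ext k; simpa using fun hk hk' => hne ⟨k, hk, hk'⟩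
    have hmem : F.gen i ∈ PointedCone.hull ℝ {F.gen i} := Submodule.subset_span rfl
    rw [h, hemp, Set.image_empty, PointedCone.hull, Submodule.span_empty] at hmem
    exact absurd ((Submodule.mem_bot _).1 hmem) (hF.gen_ne_zero i)

theorem IsQuantumFan.mem_of_gen_mem_hull [Fintype ι] (hF : F.IsQuantumFan) {K : Finset ι}
    (hK : K ∈ F.comb) {i : ι} (hi : F.gen i ∈ PointedCone.hull ℝ (F.gen '' (K : Set ι))) :
    i ∈ K := by
  obtain ⟨k, hk, t, ht, h⟩ := hF.exists_eq_smul F.gen hK hi fun k _ => hF.gen_ne_zero k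
  rwa [← hF.ray_injective (hull_singleton_eq_of_smul ht h)]

/-- Simpliciality provides some independent generating set `s` of the cone, not necessarily the
vectors of `F.gen`. Each generator of index in `K` is a nonzero multiple of an element of `s`, and
distinct indices use distinct elements because their rays differ. -/
theorem IsQuantumFan.linearIndepOn_gen [Fintype ι] (hF : F.IsQuantumFan) (hS : F.IsSimplicial)
    {K : Finset ι} (hK : K ∈ F.comb) : LinearIndepOn ℝ F.gen (K : Set ι) := by
  obtain ⟨s, hs, hli, hsK⟩ := hS _ hK
  have : Fintype s := hs.fintype
  have himg : (Subtype.val : s → Vec d) '' ((Finset.univ : Finset s) : Set s) = s := by simp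
  have key : ∀ i : (K : Set ι), ∃ x : s, ∃ t : ℝˣ, F.gen i = t • x.1 ∧
      PointedCone.hull ℝ {x.1} = PointedCone.hull ℝ {F.gen i} := by
    intro i
    obtain ⟨x, -, t, ht, h⟩ := hF.exists_eq_smul (i := i.1) (Subtype.val : s → Vec d)
      (K := Finset.univ) (by rw [himg, hsK]; exact hK)
      (by rw [himg, hsK]; exact Submodule.subset_span ⟨i.1, i.2, rfl⟩)
      (fun k _ => hli.ne_zero k.2)
    refine ⟨x, (Units.mk0 t ht.ne')⁻¹, ?_, hull_singleton_eq_of_smul ht h⟩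
    rw [h, eq_inv_smul_iff]
    rfl
  choose x t hx hray using key
  have hinj : Function.Injective x := by
    intro i j hij
    have h := hray i
    rw [hij, hray j] at h
    exact Subtype.ext (hF.ray_injective h.symm)
  have hli' : LinearIndependent ℝ fun i => (x i).1 := LinearIndependent.comp hli x hinj
  have := hli'.units_smul t
  have heq : (fun i : (K : Set ι) => F.gen i) = t • fun i => (x i).1 := by
    ext1 i; exact hx i
  change LinearIndependent ℝ fun i : (K : Set ι) => F.gen i
  rwa [heq]

/-- The positive and negative parts of `c` express one point in the cone of `K` and in that of `K'`.
The intersection of these cones is a face, so it is generated by the `F.gen i` that it contains, all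
with `i ∈ K ∩ K'`. The point thus has an expression `a` supported on `K ∩ K'`, and independence over
`K` and over `K'` identifies both parts of `c` with `a`. -/
theorem IsQuantumFan.isConeInjective [Fintype ι] (hF : F.IsQuantumFan) (hS : F.IsSimplicial) :
    IsConeInjective F.comb F.gen := by
  intro K hK K' hK' c h1 h2 h3
  have hpos : ∑ i, (c i)⁺ • F.gen i = ∑ i, (c i)⁻ • F.gen i := by
    rw [← sub_eq_zero, ← Finset.sum_sub_distrib]
    simpa [← sub_smul, posPart_sub_negPart] using h3
  have hσ : ∑ i, (c i)⁺ • F.gen i ∈ PointedCone.hull ℝ (F.gen '' (K : Set ι)) :=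
    mem_hull_image_iff.2 ⟨fun i => (c i)⁺, fun i => posPart_nonneg _,
      fun i hi => posPart_eq_zero.2 (h1 i hi), rfl⟩
  have hσ' : ∑ i, (c i)⁺ • F.gen i ∈ PointedCone.hull ℝ (F.gen '' (K' : Set ι)) :=
    mem_hull_image_iff.2 ⟨fun i => (c i)⁻, fun i => negPart_nonneg _,
      fun i hi => negPart_eq_zero.2 (h2 i hi), hpos⟩
  have hface := (hF.inter_face _ hK _ hK').1
  have hmem : ∑ i, (c i)⁺ • F.gen i ∈ PointedCone.hull ℝ (F.gen '' (K : Set ι)) ⊓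
      PointedCone.hull ℝ (F.gen '' (K' : Set ι)) := ⟨hσ, hσ'⟩
  rw [IsConeInjective.eq_hull_of_isFaceOf hface] at hmem
  obtain ⟨a, ha, ha', hac⟩ := mem_hull_image_iff.1 hmem
  have hsub : ∀ i, i ∉ K → a i = 0 := fun i hi => ha' i fun h => hi h.1
  have hsub' : ∀ i, i ∉ K' → a i = 0 := fun i hi => ha' i fun h =>
    hi (hF.mem_of_gen_mem_hull hK' h.2.2)
  have huniq : ∀ L ∈ F.comb, ∀ b : ι → ℝ, (∀ i, i ∉ L → a i = 0) → (∀ i, i ∉ L → b i = 0) →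
      ∑ i, b i • F.gen i = ∑ i, a i • F.gen i → b = a := by
    intro L hL b ha hb hab
    have hli := linearIndepOn_finset_iff.1 (hF.linearIndepOn_gen hS hL) (fun i => b i - a i) ?_
    · ext i
      by_cases hi : i ∈ L
      · exact sub_eq_zero.1 (hli i hi)
      · rw [ha i hi, hb i hi]
    · rw [Finset.sum_subset (Finset.subset_univ L) fun i _ hi => by simp [ha i hi, hb i hi]]
      simp [sub_smul, hab]
  have e1 := huniq K hK (fun i => (c i)⁺) hsub (fun i hi => posPart_eq_zero.2 (h1 i hi)) hac
  have e2 := huniq K' hK' (fun i => (c i)⁻) hsub' (fun i hi => negPart_eq_zero.2 (h2 i hi))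
    (hpos.symm.trans hac)
  ext i
  have : (c i)⁺ = (c i)⁻ := congrFun (e1.trans e2.symm) i
  rw [← posPart_sub_negPart (c i), this, sub_self, Pi.zero_apply]

theorem IsQuantumFan.isVertexComplex [Fintype ι] (hF : F.IsQuantumFan) (hS : F.IsSimplicial) :
    IsVertexComplex F.comb where
  empty_mem := by
    change PointedCone.hull ℝ _ ∈ F.cones
    simpa [PointedCone.hull] using hF.zero_mem
  singleton_mem i := by
    change PointedCone.hull ℝ _ ∈ F.cones
    simpa using hF.ray_mem i
  mem_of_subset K hK L hL :=
    hF.face_mem _ hK _ ((hF.isConeInjective hS).isFaceOf hK (Finset.coe_subset.2 hL))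

end FanData

section Realizable

variable {d p : ℕ} {D : Set (Finset (Fin p))} {v : Fin p → Vec d}

theorem IsCombinatorialType.isVertexComplex (hD : IsCombinatorialType d D) :
    IsVertexComplex D := by
  obtain ⟨F, hF, hS, rfl⟩ := hD
  exact hF.isVertexComplex hS

theorem IsConeInjective.finrank_span_hull (h : IsConeInjective D v) {K : Finset (Fin p)}
    (hK : K ∈ D) : Module.finrank ℝ (Submodule.span ℝ
      (PointedCone.hull ℝ (v '' (K : Set (Fin p))) : Set (Vec d))) = K.card := by
  have h1 : Submodule.span ℝ (PointedCone.hull ℝ (v '' (K : Set (Fin p))) : Set (Vec d)) =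
      Submodule.span ℝ (v '' (K : Set (Fin p))) := Submodule.span_span_of_tower _ ℝ _
  have h2 := (h.linearIndepOn hK).linearIndependent
  rw [h1, Set.image_eq_range, finrank_span_eq_card h2]
  simp

/-- A cone of `conesOf D v` might a priori come from another set `K'`. Injectivity then forces `K ⊆
K'`, and `D` is closed under subsets. -/
theorem hull_mem_conesOf_iff (hD : IsVertexComplex D) {v : Fin p → Vec d}
    (h : IsConeInjective D v) (K : Finset (Fin p)) :
    PointedCone.hull ℝ (v '' (K : Set (Fin p))) ∈ conesOf D v ↔ K ∈ D := by
  refine ⟨?_, fun hK => ⟨K, hK, rfl⟩⟩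
  rintro ⟨K', hK', hKK'⟩
  refine hD.mem_of_subset _ hK' _ fun i hi => h.mem_of_mem_hull hD.singleton_mem hK' ?_
  rw [← hKK']
  exact Submodule.subset_span ⟨i, hi, rfl⟩

/-- Realizability amounts to injectivity on the cones of `D`. -/
theorem isRealizable_iff (hD : IsVertexComplex D) (hd : ∃ K ∈ D, K.card = d) :
    IsRealizable D v ↔ IsConeInjective D v := by
  classical
  constructor
  · rintro ⟨F, -, rfl, hF, hS, rfl⟩
    exact hF.isConeInjective hS
  intro h
  have hcl : ∀ i, v i ∈ AddSubgroup.closure (Set.range v) :=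
    fun i => AddSubgroup.subset_closure ⟨i, rfl⟩
  have hsing : ∀ i, PointedCone.hull ℝ {v i} ∈ conesOf D v := fun i =>
    ⟨{i}, hD.singleton_mem i, by simp⟩
  have hne : ∀ i, v i ≠ 0 := fun i => (h.linearIndepOn (hD.singleton_mem i)).ne_zero (by simp)
  have hmem : ∀ {K}, K ∈ D → ∀ L : Set (Fin p), L ⊆ K →
      PointedCone.hull ℝ (v '' L) ∈ conesOf D v := by
    intro K hK L hL
    refine ⟨L.toFinite.toFinset, hD.mem_of_subset K hK _ ?_, by simp⟩
    simpa using hL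
  refine ⟨⟨AddSubgroup.closure (Set.range v), conesOf D v, v⟩, rfl, rfl, ?_, ?_, ?_⟩
  · exact
      { fg := ⟨(Set.finite_range v).toFinset, by simp⟩
        span_eq_top := by
          -- The generators of a cone of dimension `d` already span the space.
          obtain ⟨K, hK, hKd⟩ := hd
          have h1 := h.finrank_span_hull hK
          have h2 := Submodule.eq_top_of_finrank_eq
            (h1.trans (hKd.trans (finrank_euclideanSpace_fin (𝕜 := ℝ)).symm))
          rw [← top_le_iff, ← h2, Submodule.span_le]
          intro x hx
          obtain ⟨a, -, -, rfl⟩ := mem_hull_image_iff.1 hx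
          exact sum_mem fun i _ => Submodule.smul_mem _ _ (Submodule.subset_span (hcl i))
        polyhedral := by
          rintro _ ⟨K, -, rfl⟩
          refine ⟨_, Set.toFinite _, ?_, rfl⟩
          rintro _ ⟨i, -, rfl⟩
          exact hcl i
        strongly_convex := by
          rintro _ ⟨K, hK, rfl⟩ x hx hx'
          obtain ⟨a, ha, ha', rfl⟩ := mem_hull_image_iff.1 hx
          obtain ⟨b, hb, hb', hab⟩ := mem_hull_image_iff.1 hx'
          have h0 := h.eq_of_sum_eq hK hK (a := a + b) (b := 0)
            (fun i => add_nonneg (ha i) (hb i)) (fun i hi => by simp [ha' i hi, hb' i hi])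
            (fun i => le_rfl) (fun i _ => rfl)
            (by simp [add_smul, Finset.sum_add_distrib, ← hab])
          have ha0 : ∀ i, a i = 0 := fun i => by
            have : a i + b i = 0 := congrFun h0 i
            linarith [ha i, hb i]
          simp [ha0]
        zero_mem := ⟨∅, hD.empty_mem, by simp [PointedCone.hull]⟩
        face_mem := by
          rintro _ ⟨K, hK, rfl⟩ τ hτ
          rw [IsConeInjective.eq_hull_of_isFaceOf hτ]
          exact hmem hK _ fun i hi => hi.1
        inter_face := by
          rintro _ ⟨K, hK, rfl⟩ _ ⟨K', hK', rfl⟩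
          rw [h.inf_hull hK hK']
          exact ⟨h.isFaceOf hK Set.inter_subset_left, h.isFaceOf hK' Set.inter_subset_right⟩
        gen_mem := hcl
        gen_ne_zero := hne
        ray_mem := hsing
        ray_injective := by
          intro i j hij
          have h1 : v i ∈ PointedCone.hull ℝ {v j} := by
            change PointedCone.hull ℝ {v i} = PointedCone.hull ℝ {v j} at hij
            exact hij ▸ Submodule.subset_span rfl
          simpa using h.mem_of_mem_hull hD.singleton_mem (hD.singleton_mem j) (by simpa using h1)
        ray_surjective := by
          rintro _ ⟨K, hK, rfl⟩ h1
          rw [h.finrank_span_hull hK, Finset.card_eq_one] at h1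
          obtain ⟨i, rfl⟩ := h1
          exact ⟨i, by simp⟩ }
  · rintro _ ⟨K, hK, rfl⟩
    exact PointedCone.IsSimplicial.hull (Set.toFinite _)
      ((h.linearIndepOn hK).id_image)
  · ext K
    exact hull_mem_conesOf_iff hD h K

end Realizable

/-! ## Normalisation of a calibration -/

section Normalise

variable {d n p : ℕ}

/-- The linear map that sends the standard basis of `ℝ^d` to the family `w`. -/
def frameMap (w : Fin d → Vec d) : Vec d →L[ℝ] Vec d :=
  ∑ i, (EuclideanSpace.proj (𝕜 := ℝ) i).smulRight (w i)

theorem frameMap_apply (w : Fin d → Vec d) (x : Vec d) : frameMap w x = ∑ i, x i • w i := by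
  simp [frameMap]

theorem frameMap_single (w : Fin d → Vec d) (i : Fin d) :
    frameMap w (EuclideanSpace.single i 1) = w i := by
  simp [frameMap_apply]

theorem isUnit_frameMap {w : Fin d → Vec d} (hw : LinearIndependent ℝ w) :
    IsUnit (frameMap w) := by
  have hinj : Function.Injective (frameMap w : Vec d →ₗ[ℝ] Vec d) := by
    rw [injective_iff_map_eq_zero]
    intro x hx
    rw [ContinuousLinearMap.coe_coe, frameMap_apply] at hx
    ext i
    exact Fintype.linearIndependent_iff.1 hw _ hx i
  rw [ContinuousLinearMap.isUnit_iff_bijective]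
  exact ⟨hinj, LinearMap.injective_iff_surjective.1 hinj⟩

/-- The standard calibration obtained from the vectors `w_1, …, w_n` by applying the inverse of the
matrix `(w_1, …, w_d)`. -/
def normalise (hdn : d ≤ n) (w : Fin n → Vec d) : CalibrationSpace d n := fun j =>
  -- `Ring.inverse` is zero on singular matrices, so the map is total. It is meaningful and smooth
  -- where the first `d` vectors are independent.
  Ring.inverse (frameMap fun i => w (Fin.castLE hdn i)) (w ⟨d + j, by omega⟩)

theorem stdVec_castLE (hdn : d ≤ n) (ħ : CalibrationSpace d n) (i : Fin d) :
    stdVec ħ (Fin.castLE hdn i) = EuclideanSpace.single i 1 := by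
  simp [stdVec]

theorem stdVec_add (ħ : CalibrationSpace d n) (j : Fin (n - d)) :
    stdVec ħ ⟨d + j, by omega⟩ = ħ j := by
  simp [stdVec]

theorem ext_castLE_add {X : Type*} (hdn : d ≤ n) {f g : Fin n → X}
    (h1 : ∀ i, f (Fin.castLE hdn i) = g (Fin.castLE hdn i))
    (h2 : ∀ j : Fin (n - d), f ⟨d + j, by omega⟩ = g ⟨d + j, by omega⟩) : f = g := by
  ext i
  by_cases hi : i.val < d
  · exact h1 ⟨i, hi⟩
  · have := h2 ⟨i - d, by omega⟩
    have e : (⟨d + (i - d), by omega⟩ : Fin n) = i := Fin.ext (by simp; omega)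
    simpa [e] using this

theorem exists_stdVec_normalise (hdn : d ≤ n) {w : Fin n → Vec d}
    (hw : LinearIndependent ℝ fun i => w (Fin.castLE hdn i)) :
    ∃ L : Vec d ≃ₗ[ℝ] Vec d, ∀ i, stdVec (normalise hdn w) i = L (w i) := by
  obtain ⟨u, hu⟩ := isUnit_frameMap hw
  let L := (ContinuousLinearEquiv.ofUnit u).symm.toLinearEquiv
  have hL : ∀ x, L x = Ring.inverse (frameMap fun i => w (Fin.castLE hdn i)) x := by
    intro x
    rw [← hu, Ring.inverse_unit]
    rfl
  have hLw : ∀ i, L (w (Fin.castLE hdn i)) = EuclideanSpace.single i 1 := by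
    intro i
    have : w (Fin.castLE hdn i) = u.1 (EuclideanSpace.single i 1) := by
      rw [hu, frameMap_single]
    rw [this]
    exact (ContinuousLinearEquiv.ofUnit u).symm_apply_apply _
  refine ⟨L, fun i => ?_⟩
  refine congrFun (ext_castLE_add (f := stdVec (normalise hdn w)) (g := fun i => L (w i)) hdn
    (fun i => ?_) fun j => ?_) i
  · rw [stdVec_castLE, hLw]
  · rw [stdVec_add, hL]
    rfl

theorem stdVec_injective :
    Function.Injective (stdVec : CalibrationSpace d n → Fin n → Vec d) := by
  intro ħ ħ' h
  ext1 j
  rw [← stdVec_add ħ j, h, stdVec_add]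

theorem linearIndependent_of_stdVec_eq (hdn : d ≤ n) {ħ : CalibrationSpace d n}
    {w : Fin n → Vec d} (L : Vec d ≃ₗ[ℝ] Vec d) (h : ∀ i, stdVec ħ i = L (w i)) :
    LinearIndependent ℝ fun i => w (Fin.castLE hdn i) := by
  have h1 : (fun i => w (Fin.castLE hdn i)) =
      L.symm ∘ fun i => (EuclideanSpace.single i 1 : Vec d) := by
    ext1 i
    rw [Function.comp_apply, LinearEquiv.eq_symm_apply, ← h, stdVec_castLE]
  rw [h1]
  refine LinearIndependent.map' ?_ L.symm.toLinearMap L.symm.ker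
  have h2 : (fun i => (EuclideanSpace.single i 1 : Vec d)) =
      (EuclideanSpace.basisFun (Fin d) ℝ).toBasis := by
    ext1 i
    simp
  rw [h2]
  exact (EuclideanSpace.basisFun (Fin d) ℝ).toBasis.linearIndependent

/-- A linear automorphism carrying the first `d` vectors of `w` to the standard basis is unique.
With `exists_stdVec_normalise`, this characterises `normalise` and avoids computing with inverse
matrices. -/
theorem eq_normalise (hdn : d ≤ n) {ħ : CalibrationSpace d n} {w : Fin n → Vec d}
    (L : Vec d ≃ₗ[ℝ] Vec d) (h : ∀ i, stdVec ħ i = L (w i)) : ħ = normalise hdn w := by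
  obtain ⟨L', hL'⟩ := exists_stdVec_normalise hdn (linearIndependent_of_stdVec_eq hdn L h)
  have hLL : L = L' := by
    refine LinearEquiv.toLinearMap_injective ?_
    have hL : ∀ i, L.symm (EuclideanSpace.single i 1) = w (Fin.castLE hdn i) := fun i => by
      rw [LinearEquiv.symm_apply_eq, ← h, stdVec_castLE]
    have hs : L.symm = L'.symm := by
      refine LinearEquiv.toLinearMap_injective
        ((EuclideanSpace.basisFun (Fin d) ℝ).toBasis.ext fun i => ?_)
      simp only [OrthonormalBasis.coe_toBasis, EuclideanSpace.basisFun_apply,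
        LinearEquiv.coe_coe]
      rw [hL, LinearEquiv.eq_symm_apply, ← hL', stdVec_castLE]
    rw [← L.symm_symm, hs, L'.symm_symm]
  refine stdVec_injective (funext fun i => ?_)
  rw [h, hL', hLL]

theorem contDiff_stdVec (i : Fin n) :
    ContDiff ℝ ∞ fun ħ : CalibrationSpace d n => stdVec ħ i := by
  unfold stdVec
  split_ifs with h
  · exact contDiff_const
  · fun_prop

theorem contDiffAt_normalise (hdn : d ≤ n) {w : Fin n → Vec d}
    (hw : LinearIndependent ℝ fun i => w (Fin.castLE hdn i)) :
    ContDiffAt ℝ ∞ (normalise hdn) w := by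
  obtain ⟨u, hu⟩ := isUnit_frameMap hw
  have h1 : ContDiff ℝ ∞ fun w : Fin n → Vec d => frameMap fun i => w (Fin.castLE hdn i) := by
    unfold frameMap
    refine ContDiff.sum fun i _ => ?_
    exact (ContinuousLinearMap.contDiff (ContinuousLinearMap.smulRightL ℝ (Vec d) (Vec d)
      (EuclideanSpace.proj (𝕜 := ℝ) i))).comp (contDiff_apply ℝ (Vec d) _)
  have h2 : ContDiffAt ℝ ∞ (fun w : Fin n → Vec d =>
      Ring.inverse (frameMap fun i => w (Fin.castLE hdn i))) w := by
    have h3 : ContDiffAt ℝ ∞ Ring.inverse (frameMap fun i => w (Fin.castLE hdn i)) := by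
      rw [← hu]
      exact contDiffAt_ringInverse ℝ u
    exact h3.comp w h1.contDiffAt
  rw [contDiffAt_pi]
  intro j
  exact h2.clm_apply (contDiff_apply ℝ (Vec d) _).contDiffAt

end Normalise

/-! ## Renumbering of a standard calibration -/

section Renumber

variable {d n p : ℕ} {D D' : Set (Finset (Fin p))}

/-- The standard calibration obtained by renumbering the generators of `ħ`. -/
def renumber (hdn : d ≤ n) (g : Equiv.Perm (Fin n)) (ħ : CalibrationSpace d n) :
    CalibrationSpace d n :=
  normalise hdn fun i => stdVec ħ (g i)

/-- `D` is a simplicial complex that contains `{1, …, d}`. -/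
structure IsAdaptedComplex (d : ℕ) {p : ℕ} (D : Set (Finset (Fin p))) : Prop
    extends IsVertexComplex D where
  le : d ≤ p
  filter_mem : (Finset.univ.filter fun i : Fin p => i.val < d) ∈ D

theorem IsAdaptedComplex.exists_card (hD : IsAdaptedComplex d D) : ∃ K ∈ D, K.card = d :=
  ⟨_, hD.filter_mem, by rw [Fin.card_filter_val_lt, min_eq_right hD.le]⟩

theorem mem_realizableSet_iff (hpn : p ≤ n) (hD : IsAdaptedComplex d D)
    {ħ : CalibrationSpace d n} :
    ħ ∈ realizableSet hpn D ↔ IsConeInjective D fun i => stdVec ħ (Fin.castLE hpn i) :=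
  isRealizable_iff hD.toIsVertexComplex hD.exists_card

theorem isOpen_realizableSet (hpn : p ≤ n) (hD : IsAdaptedComplex d D) :
    IsOpen (realizableSet (d := d) hpn D) := by
  have h : realizableSet (d := d) hpn D =
      (fun ħ i => stdVec ħ (Fin.castLE hpn i)) ⁻¹' {v : Fin p → Vec d | IsConeInjective D v} := by
    ext ħ
    exact mem_realizableSet_iff hpn hD
  rw [h]
  exact (isOpen_setOf_isConeInjective D).preimage
    (continuous_pi fun i => (contDiff_stdVec _).continuous)

theorem IsConeInjective.linearIndependent_castLE (hD : IsAdaptedComplex d D) {v : Fin p → Vec d}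
    (h : IsConeInjective D v) : LinearIndependent ℝ fun i => v (Fin.castLE hD.le i) := by
  have h1 : LinearIndependent ℝ fun i : ((Finset.univ.filter fun i : Fin p => i.val < d : Finset _)
    : Set (Fin p)) => v i := h.linearIndepOn hD.filter_mem
  exact h1.comp (fun i : Fin d => ⟨Fin.castLE hD.le i, by simp⟩)
    fun i j hij => Fin.castLE_injective hD.le (congrArg Subtype.val hij)

theorem normalise_mem_realizableSet (hdn : d ≤ n) (hpn : p ≤ n) (hD : IsAdaptedComplex d D)
    {w : Fin n → Vec d} (hw : IsConeInjective D fun i => w (Fin.castLE hpn i)) :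
    normalise hdn w ∈ realizableSet hpn D := by
  obtain ⟨L, hL⟩ := exists_stdVec_normalise hdn (hw.linearIndependent_castLE hD)
  rw [mem_realizableSet_iff hpn hD]
  simp only [hL]
  exact hw.comp_injective L.toLinearMap L.injective

/-- The renumbering by `g`, whose restriction `s` to `{1, …, p}` maps `D` to `D'`. -/
theorem isConeInjective_renumber (hpn : p ≤ n)
    (hD' : IsAdaptedComplex d D') {g : Equiv.Perm (Fin n)} {s : Equiv.Perm (Fin p)}
    (hg : ∀ i, g (Fin.castLE hpn i) = Fin.castLE hpn (s i))
    (hs : ∀ K : Finset (Fin p), K ∈ D ↔ K.map s.toEmbedding ∈ D')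
    {ħ : CalibrationSpace d n} (hħ : ħ ∈ realizableSet hpn D') :
    IsConeInjective D fun i => stdVec ħ (g (Fin.castLE hpn i)) := by
  simp only [hg]
  exact ((mem_realizableSet_iff hpn hD').1 hħ).reindex s fun K hK => (hs K).1 hK

theorem contDiffAt_renumber (hdn : d ≤ n) (hpn : p ≤ n) (hD : IsAdaptedComplex d D)
    {g : Equiv.Perm (Fin n)} {ħ : CalibrationSpace d n}
    (h : IsConeInjective D fun i => stdVec ħ (g (Fin.castLE hpn i))) :
    ContDiffAt ℝ ∞ (renumber hdn g) ħ := by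
  refine ContDiffAt.comp ħ (contDiffAt_normalise hdn ?_)
    (contDiffAt_pi.2 fun i => (contDiff_stdVec _).contDiffAt)
  exact h.linearIndependent_castLE hD

end Renumber

/-! ## Isomorphisms of calibrated quantum fans -/

/-- An automorphism of `ℤ^n` that is nonnegative together with its inverse permutes the standard
basis. -/
theorem exists_perm_of_nonneg {n : ℕ} (H H' : (Fin n → ℤ) →+ (Fin n → ℤ))
    (h1 : ∀ x, H' (H x) = x) (h2 : ∀ x, H (H' x) = x)
    (hH : ∀ i j, 0 ≤ H (Pi.single i 1) j) (hH' : ∀ i j, 0 ≤ H' (Pi.single i 1) j) :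
    ∃ g : Equiv.Perm (Fin n), ∀ i, H (Pi.single i 1) = Pi.single (g i) 1 := by
  have key : ∀ i, ∃ j, H (Pi.single i 1) = Pi.single j 1 := by
    intro i
    have hne : H (Pi.single i 1) ≠ 0 := by
      intro h
      have := h1 (Pi.single i 1)
      rw [h, map_zero] at this
      simpa using congrFun this i
    obtain ⟨j, hj⟩ := Function.ne_iff.1 hne
    have hpos : 1 ≤ H (Pi.single i 1) j :=
      Int.add_one_le_iff.2 (lt_of_le_of_ne (hH i j) (Ne.symm hj))
    -- The identity `H' (H e_i) = e_i` is expanded over the coordinates of `H e_i`. All terms are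
    -- nonnegative and the coefficient at `j` is at least `1`, so `H' e_j ≤ e_i` coordinatewise.
    -- Hence `H' e_j` is `0` or `e_i`, and injectivity of `H'` excludes `0`.
    have hsum : ∀ k, (Pi.single i 1 : Fin n → ℤ) k =
        ∑ l, H (Pi.single i 1) l * H' (Pi.single l 1) k := by
      intro k
      have e : H (Pi.single i 1) = ∑ l, H (Pi.single i 1) l • (Pi.single l 1 : Fin n → ℤ) := by
        ext m; simp [Finset.sum_apply, Pi.single_apply]
      conv_lhs => rw [← h1 (Pi.single i 1), e, map_sum, Finset.sum_apply]
      exact Finset.sum_congr rfl fun l _ => by rw [map_zsmul, Pi.smul_apply, smul_eq_mul]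
    have hle : ∀ k, H' (Pi.single j 1) k ≤ (Pi.single i 1 : Fin n → ℤ) k := by
      intro k
      rw [hsum k]
      have h3 := Finset.single_le_sum (f := fun l => H (Pi.single i 1) l * H' (Pi.single l 1) k)
        (fun l _ => mul_nonneg (hH i l) (hH' l k)) (Finset.mem_univ j)
      exact (le_mul_of_one_le_left (hH' j k) hpos).trans h3
    have hzero : ∀ k, k ≠ i → H' (Pi.single j 1) k = 0 := by
      intro k hk
      have := hle k
      rw [Pi.single_eq_of_ne hk] at this
      exact le_antisymm this (hH' j k)
    have hi : H' (Pi.single j 1) i = 1 := by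
      have h4 := hle i
      rw [Pi.single_eq_same] at h4
      have h5 := hH' j i
      by_contra h6
      have h7 : H' (Pi.single j 1) = 0 := by
        ext k
        by_cases hk : k = i
        · subst hk; simp only [Pi.zero_apply]; omega
        · exact hzero k hk
      have := h2 (Pi.single j 1)
      rw [h7, map_zero] at this
      simpa using congrFun this j
    refine ⟨j, ?_⟩
    have h8 : H' (Pi.single j 1) = Pi.single i 1 := by
      ext k
      by_cases hk : k = i
      · subst hk; simpa using hi
      · rw [hzero k hk, Pi.single_eq_of_ne hk]
    rw [← h8, h2]
  choose g hg using key
  have hinj : Function.Injective g := by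
    intro i i' h
    have h3 : H (Pi.single i 1) = H (Pi.single i' 1) := by rw [hg, hg, h]
    have h4 := congrArg H' h3
    rw [h1, h1] at h4
    by_contra hne
    simpa [Pi.single_eq_of_ne hne] using congrFun h4 i
  exact ⟨Equiv.ofBijective g (Finite.injective_iff_bijective.1 hinj), hg⟩

namespace CalibratedQuantumFan

variable {d n : ℕ} {F F' : CalibratedQuantumFan d n}

theorem IsMaximal.J_eq (hF : F.IsMaximal) : F.J = F.Iᶜ := by
  refine Finset.eq_of_subset_of_card_le (fun i hi => ?_) ?_
  · exact Finset.mem_compl.2 fun hi' => Finset.disjoint_left.1 F.disjoint hi' hi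
  · rw [hF, Finset.card_compl, Fintype.card_fin]

/-- A permutation `g` of the basis of `ℤ^n` and a linear automorphism `L` of `ℝ^d` that transform
`F` into `F'`. -/
structure IsRelabelling (F F' : CalibratedQuantumFan d n) (g : Equiv.Perm (Fin n))
    (L : Vec d ≃ₗ[ℝ] Vec d) : Prop where
  mem_I : ∀ i, i ∈ F.I ↔ g i ∈ F'.I
  mem_J : ∀ i, i ∈ F.J ↔ g i ∈ F'.J
  map_single : ∀ i, L (F.h (Pi.single i 1)) = F'.h (Pi.single (g i) 1)
  map_cone : ∀ σ, σ ∈ F.cones ↔ σ.map L.toLinearMap ∈ F'.cones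

theorem map_map_symm (L : Vec d ≃ₗ[ℝ] Vec d) (σ : PointedCone ℝ (Vec d)) :
    (σ.map L.symm.toLinearMap).map L.toLinearMap = σ := by
  rw [PointedCone.map_map]
  simp

theorem IsRelabelling.symm {g : Equiv.Perm (Fin n)} {L : Vec d ≃ₗ[ℝ] Vec d}
    (h : IsRelabelling F F' g L) : IsRelabelling F' F g.symm L.symm where
  mem_I i := by rw [h.mem_I, Equiv.apply_symm_apply]
  mem_J i := by rw [h.mem_J, Equiv.apply_symm_apply]
  map_single i := by
    rw [LinearEquiv.symm_apply_eq, h.map_single, Equiv.apply_symm_apply]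
  map_cone σ := by rw [h.map_cone, map_map_symm]

/-- The automorphism of `ℤ^n` that permutes the standard basis. -/
def permHom (g : Equiv.Perm (Fin n)) : (Fin n → ℤ) →+ (Fin n → ℤ) where
  toFun x i := x (g.symm i)
  map_zero' := rfl
  map_add' _ _ := rfl

theorem permHom_single (g : Equiv.Perm (Fin n)) (i : Fin n) :
    permHom g (Pi.single i 1) = Pi.single (g i) 1 := by
  ext j
  simp [permHom, Pi.single_apply, Equiv.symm_apply_eq]

theorem realExt_permHom_single (g : Equiv.Perm (Fin n)) (i : Fin n) :
    realExt (permHom g) (intVec n (Pi.single i 1)) = intVec n (Pi.single (g i) 1) := by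
  rw [realExt_intVec, permHom_single]

/-- The morphism defined by a relabelling. -/
def IsRelabelling.hom {g : Equiv.Perm (Fin n)} {L : Vec d ≃ₗ[ℝ] Vec d}
    (h : IsRelabelling F F' g L) : Hom F F' :=
  have hcomm : ∀ x, L (F.h x) = F'.h (permHom g x) := by
    intro x
    have : L.toLinearMap.toAddMonoidHom.comp F.h = F'.h.comp (permHom g) := by
      refine AddMonoidHom.functions_ext' _ _ _ fun i => AddMonoidHom.ext_int ?_
      simp only [AddMonoidHom.comp_apply, AddMonoidHom.single_apply, permHom_single]
      exact h.map_single i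
    exact DFunLike.congr_fun this x
  { L := L.toLinearMap
    H := permHom g
    isMorphism_L :=
      { map_lattice := by
          rintro _ ⟨x, rfl⟩
          exact ⟨permHom g x, (hcomm x).symm⟩
        map_cone := fun σ hσ => ⟨σ.map L.toLinearMap, (h.map_cone σ).1 hσ,
          fun x hx => PointedCone.mem_map.2 ⟨x, hx, rfl⟩⟩
        map_gen := by
          rintro ⟨i, hi⟩ σ' - hm
          have e : L.toLinearMap (F.fan.gen ⟨i, hi⟩) = F'.fan.gen ⟨g i, (h.mem_I i).1 hi⟩ :=
            h.map_single i
          rw [e] at hm ⊢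
          exact AddSubmonoid.subset_closure ⟨_, hm, rfl⟩ }
    isMorphism_H :=
      { map_lattice := by
          rintro _ ⟨x, rfl⟩
          exact ⟨permHom g x, (realExt_intVec _ _).symm⟩
        map_cone := by
          rintro _ ⟨σ, hσ, rfl⟩
          refine ⟨_, ⟨σ.map L.toLinearMap, (h.map_cone σ).1 hσ, rfl⟩, fun x hx => ?_⟩
          have hx' : realExt (permHom g) x ∈ PointedCone.map (realExt (permHom g)) _ :=
            PointedCone.mem_map.2 ⟨x, hx, rfl⟩
          rw [map_hull] at hx'
          refine Submodule.span_mono ?_ hx'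
          rintro _ ⟨_, ⟨i, hi, hiσ, rfl⟩, rfl⟩
          exact ⟨g i, (h.mem_I i).1 hi, PointedCone.mem_map.2 ⟨_, hiσ, h.map_single i⟩,
            realExt_permHom_single g i⟩
        map_gen := by
          rintro ⟨i, hi⟩ σ' - hm
          have e : realExt (permHom g) (F.assocFan.gen ⟨i, hi⟩) =
              F'.assocFan.gen ⟨g i, (h.mem_I i).1 hi⟩ := realExt_permHom_single g i
          rw [e] at hm ⊢
          exact AddSubmonoid.subset_closure ⟨_, hm, rfl⟩ }
    comm := hcomm
    map_notMem := fun i hi j hj => by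
      rw [permHom_single, Pi.single_eq_of_ne]
      rintro rfl
      exact hi ((h.mem_J i).2 hj)
    map_virtual := ⟨fun i => ⟨g i, (h.mem_J i).1 i.2⟩, fun i => permHom_single g i⟩ }

theorem IsRelabelling.isIsomorphic {g : Equiv.Perm (Fin n)} {L : Vec d ≃ₗ[ℝ] Vec d}
    (h : IsRelabelling F F' g L) : IsIsomorphic F F' := by
  refine ⟨⟨h.hom, h.symm.hom, ?_, ?_⟩⟩
  · refine Hom.ext ?_ ?_
    · exact LinearMap.ext fun x => L.symm_apply_apply x
    · refine AddMonoidHom.ext fun x => funext fun i => ?_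
      exact congrArg x (g.symm_apply_apply i)
  · refine Hom.ext ?_ ?_
    · exact LinearMap.ext fun x => L.apply_symm_apply x
    · refine AddMonoidHom.ext fun x => funext fun i => ?_
      exact congrArg x (g.apply_symm_apply i)

/-- The associated linear map sends the basis vectors of the generators to nonnegative combinations
of basis vectors of generators. -/
theorem Hom.apply_single_nonneg (f : Hom F F') {i : Fin n} (hi : i ∈ F.I) :
    (∀ j, 0 ≤ f.H (Pi.single i 1) j) ∧ ∀ j, j ∉ F'.I → f.H (Pi.single i 1) j = 0 := by
  obtain ⟨_, ⟨σ', -, rfl⟩, h⟩ := f.isMorphism_H.map_cone _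
    ⟨_, F.isQuantumFan.ray_mem ⟨i, hi⟩, rfl⟩
  have h1 := h (intVec n (Pi.single i 1))
    (Submodule.subset_span ⟨i, hi, Submodule.subset_span rfl, rfl⟩)
  have e : {w | ∃ i ∈ F'.I, F'.h (Pi.single i 1) ∈ σ' ∧ w = intVec n (Pi.single i 1)} =
      {w | ∃ i ∈ {i | i ∈ F'.I ∧ F'.h (Pi.single i 1) ∈ σ'}, w = intVec n (Pi.single i 1)} := by
    ext w; simp [and_assoc]
  rw [e, mem_coordCone, realExt_intVec] at h1
  refine ⟨fun j => ?_, fun j hj => ?_⟩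
  · have : (0 : ℝ) ≤ (f.H (Pi.single i 1) j : ℤ) := h1.1 j
    exact_mod_cast this
  · have : ((f.H (Pi.single i 1) j : ℤ) : ℝ) = 0 := h1.2 j fun h => hj h.1
    exact_mod_cast this

/-- Maximal length enters here: every basis vector is either a generator of a `1`-cone or virtual,
and a virtual one is sent to a basis vector. -/
theorem Hom.apply_single_nonneg_of_isMaximal (f : Hom F F') (hF : F.IsMaximal) (i j : Fin n) :
    0 ≤ f.H (Pi.single i 1) j := by
  by_cases hi : i ∈ F.I
  · exact (f.apply_single_nonneg hi).1 j
  · have hiJ : i ∈ F.J := by rw [hF.J_eq]; exact Finset.mem_compl.2 hi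
    obtain ⟨s, hs⟩ := f.map_virtual
    have h := hs ⟨i, hiJ⟩
    dsimp only at h
    rw [h]
    by_cases hj : j = (s ⟨i, hiJ⟩).1
    · rw [hj]; simp
    · simp [hj]

theorem Hom.mem_I (f : Hom F F') {i j : Fin n} (hi : i ∈ F.I)
    (h : f.H (Pi.single i 1) = Pi.single j 1) : j ∈ F'.I := by
  by_contra hj
  have := (f.apply_single_nonneg hi).2 j hj
  rw [h] at this
  simp at this

theorem Hom.mem_J (f : Hom F F') {i j : Fin n} (hi : i ∈ F.J)
    (h : f.H (Pi.single i 1) = Pi.single j 1) : j ∈ F'.J := by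
  obtain ⟨s, hs⟩ := f.map_virtual
  have h1 := (hs ⟨i, hi⟩).symm.trans h
  by_contra hj
  have hne : j ≠ (s ⟨i, hi⟩).1 := fun h => hj (h ▸ (s ⟨i, hi⟩).2)
  have h2 := congrFun h1 j
  simp [hne] at h2

/-- A morphism only guarantees that the image of `σ` lies inside some cone of the target. As `f.H`
sends basis vectors injectively to basis vectors, that image is generated by some of the generators
of a simplicial cone, hence is one of its faces. -/
theorem Hom.map_mem_cones (f : Hom F F') (hF : F.fan.IsSimplicial) (hF' : F'.fan.IsSimplicial)
    {g : Fin n → Fin n} (hg : Function.Injective g)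
    (h : ∀ i, f.H (Pi.single i 1) = Pi.single (g i) 1) {σ : PointedCone ℝ (Vec d)}
    (hσ : σ ∈ F.cones) : σ.map f.L ∈ F'.cones := by
  have hQ : F.fan.IsQuantumFan := F.isQuantumFan
  have hQ' : F'.fan.IsQuantumFan := F'.isQuantumFan
  obtain ⟨σ', hσ', hmap⟩ := f.isMorphism_L.map_cone σ hσ
  have h1 : σ ∈ F.fan.cones := hσ
  rw [hQ.cones_eq hF] at h1
  rw [hQ'.cones_eq hF'] at hσ'
  obtain ⟨K, -, rfl⟩ := h1
  obtain ⟨K', hK', rfl⟩ := hσ'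
  let e : F.I ↪ F'.I := ⟨fun i => ⟨g i, f.mem_I i.2 (h i)⟩, fun i j hij =>
    Subtype.ext (hg (congrArg Subtype.val hij))⟩
  have hgen : ∀ i, f.L (F.fan.gen i) = F'.fan.gen (e i) := fun i =>
    (f.comm _).trans (congrArg F'.h (h i))
  have hsub : K.map e ⊆ K' := by
    intro j hj
    obtain ⟨i, hi, rfl⟩ := Finset.mem_map.1 hj
    refine hQ'.mem_of_gen_mem_hull hK' ?_
    rw [← hgen]
    exact hmap _ (Submodule.subset_span ⟨i, hi, rfl⟩)
  have hcomb := (hQ'.isVertexComplex hF').mem_of_subset _ hK' _ hsub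
  have himg : f.L '' (F.fan.gen '' (K : Set F.I)) =
      F'.fan.gen '' ((K.map e : Finset F'.I) : Set F'.I) := by
    rw [Finset.coe_map, Set.image_image, Set.image_image]
    exact Set.image_congr fun i _ => hgen i
  rw [map_hull, himg]
  exact hcomb

/-- Isomorphic calibrated quantum fans of maximal length differ by a relabelling. -/
theorem exists_isRelabelling (hF : F.IsMaximal) (hF' : F'.IsMaximal) (hS : F.fan.IsSimplicial)
    (hS' : F'.fan.IsSimplicial) (hiso : IsIsomorphic F F') :
    ∃ g L, IsRelabelling F F' g L := by
  obtain ⟨f⟩ := hiso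
  let a : Hom F F' := f.hom
  let b : Hom F' F := f.inv
  have hab : a.comp b = Hom.id F := f.hom_inv_id
  have hba : b.comp a = Hom.id F' := f.inv_hom_id
  have hL1 : b.L ∘ₗ a.L = LinearMap.id := congrArg Hom.L hab
  have hL2 : a.L ∘ₗ b.L = LinearMap.id := congrArg Hom.L hba
  have hH1 : b.H.comp a.H = AddMonoidHom.id _ := congrArg Hom.H hab
  have hH2 : a.H.comp b.H = AddMonoidHom.id _ := congrArg Hom.H hba
  obtain ⟨g, hg⟩ := exists_perm_of_nonneg a.H b.H (DFunLike.congr_fun hH1)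
    (DFunLike.congr_fun hH2) (a.apply_single_nonneg_of_isMaximal hF)
    (b.apply_single_nonneg_of_isMaximal hF')
  have hg' : ∀ i, b.H (Pi.single i 1) = Pi.single (g.symm i) 1 := by
    intro i
    have h := DFunLike.congr_fun hH1 (Pi.single (g.symm i) 1)
    rw [AddMonoidHom.comp_apply, hg, g.apply_symm_apply] at h
    exact h
  refine ⟨g, LinearEquiv.ofLinearMap a.L b.L hL2 hL1, ⟨fun i => ⟨fun hi => ?_, fun hi => ?_⟩,
    fun i => ⟨fun hi => ?_, fun hi => ?_⟩, fun i => ?_, fun σ => ⟨fun hσ => ?_, fun hσ => ?_⟩⟩⟩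
  · exact a.mem_I hi (hg i)
  · simpa using b.mem_I hi (hg' (g i))
  · exact a.mem_J hi (hg i)
  · simpa using b.mem_J hi (hg' (g i))
  · exact (a.comm _).trans (congrArg F'.h (hg i))
  · exact a.map_mem_cones hS hS' g.injective hg hσ
  · have h := b.map_mem_cones hS' hS g.symm.injective hg' hσ
    rw [PointedCone.map_map] at h
    have e : b.L ∘ₗ (LinearEquiv.ofLinearMap a.L b.L hL2 hL1).toLinearMap = LinearMap.id := hL1
    rwa [e, PointedCone.map_id] at h

end CalibratedQuantumFan

/-! ## Standard calibrated fans in the moduli space -/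

section BlockPerm

variable {n p : ℕ} (hpn : p ≤ n)

theorem blockPerm_castLE (s : Equiv.Perm (Fin p)) (t : Equiv.Perm (Fin (n - p))) (i : Fin p) :
    blockPerm hpn s t (Fin.castLE hpn i) = Fin.castLE hpn (s i) := by
  have h : ∀ i : Fin p, (finSumFinEquiv.trans (finCongr (Nat.add_sub_of_le hpn))) (Sum.inl i) =
      Fin.castLE hpn i := fun i => by ext; simp
  rw [blockPerm, Equiv.permCongr_apply, ← h, Equiv.symm_apply_apply, Equiv.sumCongr_apply,
    Sum.map_inl, h]

theorem blockPerm_one : blockPerm hpn 1 1 = 1 := by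
  ext i
  simp [blockPerm]

theorem blockPerm_mul (s s' : Equiv.Perm (Fin p)) (t t' : Equiv.Perm (Fin (n - p))) :
    blockPerm hpn (s * s') (t * t') = blockPerm hpn s t * blockPerm hpn s' t' := by
  rw [blockPerm, blockPerm, blockPerm, ← Equiv.permCongr_mul]
  congr 1
  ext x
  cases x <;> rfl

theorem lt_iff_of_castLE {g : Equiv.Perm (Fin n)} {s : Equiv.Perm (Fin p)}
    (hg : ∀ i, g (Fin.castLE hpn i) = Fin.castLE hpn (s i)) (i : Fin n) :
    i.val < p ↔ (g i).val < p := by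
  constructor
  · intro hi
    have := hg ⟨i, hi⟩
    have e : Fin.castLE hpn ⟨i, hi⟩ = i := rfl
    rw [← e, this]
    simp
  · intro hi
    have h1 := hg (s.symm ⟨g i, hi⟩)
    rw [Equiv.apply_symm_apply] at h1
    have h2 : Fin.castLE hpn (s.symm ⟨g i, hi⟩) = i := g.injective h1
    rw [← h2]
    simp

/-- After transport along `Fin p ⊕ Fin (n - p) ≃ Fin n`, a permutation preserving the left summand
is a sum of two permutations. -/
theorem exists_eq_blockPerm {g : Equiv.Perm (Fin n)} (hg : ∀ i : Fin n, i.val < p ↔ (g i).val < p) :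
    ∃ s t, g = blockPerm hpn s t := by
  let c := finSumFinEquiv.trans (finCongr (Nat.add_sub_of_le hpn))
  have hc : ∀ x, (c x).val < p ↔ ∃ i, Sum.inl i = x := by
    rintro (i | i) <;> simp [c]
  have h := Equiv.Perm.mem_sumCongrHom_range_of_perm_mapsTo_inl (σ := c.permCongr.symm g) (by
    rintro _ ⟨i, rfl⟩
    have h1 := (hg (c (Sum.inl i))).1 ((hc _).2 ⟨i, rfl⟩)
    refine (hc _).1 ?_
    simpa using h1)
  obtain ⟨⟨s, t⟩, hst⟩ := h
  refine ⟨s, t, ?_⟩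
  rw [blockPerm, ← Equiv.symm_apply_eq]
  exact hst.symm

theorem blockH_symm_single (s : Equiv.Perm (Fin p)) (t : Equiv.Perm (Fin (n - p))) (i : Fin n) :
    (blockH hpn s t).symm (Pi.single i 1) = Pi.single (blockPerm hpn s t i) 1 := by
  ext j
  change (Pi.single i 1 : Fin n → ℤ) ((blockPerm hpn s t).symm j) = _
  simp [Pi.single_apply, Equiv.symm_apply_eq]

/-- The normalisation of `L` follows from the formula for the calibration, because the first `d`
standard vectors of `ħ'` are the standard basis. -/
theorem isTransition_iff {d : ℕ} {D : Set (Finset (Fin p))} {s : Equiv.Perm (Fin p)}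
    {t : Equiv.Perm (Fin (n - p))} {ħ ħ' : CalibrationSpace d n} :
    IsTransition hpn D s t ħ ħ' ↔ (∀ K : Finset (Fin p), K ∈ D ↔ K.map s.toEmbedding ∈ D) ∧
      ∃ L : Vec d ≃ₗ[ℝ] Vec d, ∀ i, stdVec ħ' i = L (stdVec ħ (blockPerm hpn s t i)) := by
  refine and_congr_right fun _ => exists_congr fun L => ⟨fun h i => ?_, fun h => ⟨fun i hi => ?_,
    fun x => ?_⟩⟩
  · have := h.2 (Pi.single i 1)
    rwa [blockH_symm_single, stdCalibration_single, stdCalibration_single] at this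
  · rw [← blockPerm_castLE hpn s t, ← h]
    simp [stdVec, hi]
  · have : stdCalibration ħ' = (L.toLinearMap.toAddMonoidHom.comp (stdCalibration ħ)).comp
        (blockH hpn s t).symm.toAddMonoidHom := by
      refine AddMonoidHom.functions_ext' _ _ _ fun i => AddMonoidHom.ext_int ?_
      simp only [AddMonoidHom.comp_apply, AddMonoidHom.single_apply]
      have e : (blockH hpn s t).symm.toAddMonoidHom (Pi.single i 1) =
        Pi.single (blockPerm hpn s t i) 1 := blockH_symm_single hpn s t i
      rw [e, stdCalibration_single, stdCalibration_single]
      exact h i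
    exact DFunLike.congr_fun this x

end BlockPerm

section Moduli

variable {d n p : ℕ} {D D' D'' : Set (Finset (Fin p))}

theorem image_map_equiv {ι ι' E E' : Type*} (e : ι ≃ ι') {v : ι → E} {v' : ι' → E'} (L : E → E')
    (h : ∀ i, L (v i) = v' (e i)) (K : Finset ι) :
    L '' (v '' (K : Set ι)) = v' '' ((K.map e.toEmbedding : Finset ι') : Set ι') := by
  rw [Finset.coe_map, Set.image_image, Set.image_image]
  exact Set.image_congr fun i _ => h i

theorem mem_cones_iff_map {ι ι' : Type*} (e : ι ≃ ι') {C : Set (Finset ι)}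
    {C' : Set (Finset ι')} (he : ∀ K, K ∈ C ↔ K.map e.toEmbedding ∈ C') {v : ι → Vec d}
    {v' : ι' → Vec d} (L : Vec d ≃ₗ[ℝ] Vec d) (h : ∀ i, L (v i) = v' (e i))
    (σ : PointedCone ℝ (Vec d)) :
    σ ∈ {σ | ∃ K ∈ C, σ = PointedCone.hull ℝ (v '' (K : Set ι))} ↔
      σ.map L.toLinearMap ∈ {σ | ∃ K ∈ C', σ = PointedCone.hull ℝ (v' '' (K : Set ι'))} := by
  constructor
  · rintro ⟨K, hK, rfl⟩
    refine ⟨_, (he K).1 hK, ?_⟩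
    rw [map_hull, ← image_map_equiv e L h]
    rfl
  · rintro ⟨K, hK, hσ⟩
    have hKe : (K.map e.symm.toEmbedding).map e.toEmbedding = K := by
      rw [Finset.map_map]; simp
    refine ⟨K.map e.symm.toEmbedding, (he _).2 (by rwa [hKe]), ?_⟩
    rw [← hKe, ← image_map_equiv e L h] at hσ
    have h1 := congrArg (PointedCone.map L.symm.toLinearMap) hσ
    rw [PointedCone.map_map, map_hull, Set.image_image] at h1
    simpa using h1

theorem IsCombinatorialType.isAdaptedComplex (hD : IsCombinatorialType d D)
    (hcone : ∃ K ∈ D, K.card = d) (hD' : IsAdaptedNumbering d D D') : IsAdaptedComplex d D' where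
  toIsVertexComplex := by
    obtain ⟨⟨s, hs⟩, -⟩ := hD'
    exact hD.isVertexComplex.of_perm s hs
  le := by
    obtain ⟨K, -, rfl⟩ := hcone
    simpa using K.card_le_univ
  filter_mem := hD'.2

theorem exists_isAdaptedNumbering (hcone : ∃ K ∈ D, K.card = d) :
    ∃ D', IsAdaptedNumbering d D D' := by
  obtain ⟨K, hK, hKd⟩ := hcone
  have hdp : d ≤ p := by simpa [hKd] using K.card_le_univ
  let e : {i // i ∈ K} ≃ {i // i ∈ Finset.univ.filter fun i : Fin p => i.val < d} :=
    Finset.equivOfCardEq (by rw [hKd, Fin.card_filter_val_lt, min_eq_right hdp])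
  let s : Equiv.Perm (Fin p) := e.extendSubtype
  have hinv : ∀ K : Finset (Fin p), (K.map s.toEmbedding).map s.symm.toEmbedding = K := by
    intro K; rw [Finset.map_map]; simp
  refine ⟨{K | K.map s.symm.toEmbedding ∈ D}, ⟨s, fun K => ?_⟩, ?_⟩
  · rw [Set.mem_ofPred_eq, hinv]
  · have : K.map s.toEmbedding = Finset.univ.filter fun i : Fin p => i.val < d := by
      refine Finset.eq_of_subset_of_card_le (fun j hj => ?_) ?_
      · obtain ⟨i, hi, rfl⟩ := Finset.mem_map.1 hj
        exact Equiv.extendSubtype_mem e i hi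
      · rw [Finset.card_map, hKd, Fin.card_filter_val_lt, min_eq_right hdp]
    rw [Set.mem_ofPred_eq, ← this, hinv]
    exact hK

/-- Allowing two complexes covers both a transition within one numbering and a change of numbering.
-/
theorem stdFan_isRelabelling (hpn : p ≤ n) (ħ' : realizableSet (d := d) hpn D')
    (ħ'' : realizableSet (d := d) hpn D'') {g : Equiv.Perm (Fin n)} {s : Equiv.Perm (Fin p)}
    (hg : ∀ i, g (Fin.castLE hpn i) = Fin.castLE hpn (s i))
    (hs : ∀ K : Finset (Fin p), K ∈ D' ↔ K.map s.toEmbedding ∈ D'')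
    (L : Vec d ≃ₗ[ℝ] Vec d) (h : ∀ i, stdVec ħ'.1 i = L (stdVec ħ''.1 (g i))) :
    CalibratedQuantumFan.IsRelabelling (stdFan hpn D' ħ') (stdFan hpn D'' ħ'') g L.symm where
  mem_I i := by simpa [stdFan] using lt_iff_of_castLE hpn hg i
  mem_J i := by simpa [stdFan] using not_congr (lt_iff_of_castLE hpn hg i)
  map_single i := by
    change L.symm (stdCalibration ħ'.1 _) = stdCalibration ħ''.1 _
    rw [stdCalibration_single, stdCalibration_single, h, L.symm_apply_apply]
  map_cone σ := mem_cones_iff_map s hs L.symm (fun i => by rw [h, L.symm_apply_apply, hg]) σ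

theorem toModuli_eq_iff_isIsomorphic (hpn : p ≤ n) (hD' : IsAdaptedNumbering d D D')
    (hD'' : IsAdaptedNumbering d D D'') (ħ' : realizableSet (d := d) hpn D')
    (ħ'' : realizableSet (d := d) hpn D'') :
    toModuli hpn hD' ħ' = toModuli hpn hD'' ħ'' ↔
      IsIsomorphic (stdFan hpn D' ħ') (stdFan hpn D'' ħ'') :=
  Quotient.eq

theorem toModuli_eq_iff (hpn : p ≤ n) (hA : IsAdaptedComplex d D')
    (hD' : IsAdaptedNumbering d D D') (ħ ħ' : realizableSet (d := d) hpn D') :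
    toModuli hpn hD' ħ = toModuli hpn hD' ħ' ↔
      ∃ (s : Equiv.Perm (Fin p)) (t : Equiv.Perm (Fin (n - p))),
        IsTransition hpn D' s t ħ.1 ħ'.1 := by
  -- A transition expresses the vector of index `i` of `ħ'` by that of index `blockPerm hpn s t i`
  -- of `ħ`, so the permutation goes from the fan of `ħ'` to that of `ħ`.
  rw [eq_comm, toModuli_eq_iff_isIsomorphic]
  constructor
  · intro h
    have ht := stdFan_isOfType hpn hD' ħ
    have ht' := stdFan_isOfType hpn hD' ħ'
    obtain ⟨g, L, hL⟩ := CalibratedQuantumFan.exists_isRelabelling ht'.2.1 ht.2.1 ht'.1 ht.1 h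
    have hvec : ∀ i, L (stdVec ħ'.1 i) = stdVec ħ.1 (g i) := by
      intro i
      have := hL.map_single i
      change L (stdCalibration ħ'.1 _) = stdCalibration ħ.1 _ at this
      rwa [stdCalibration_single, stdCalibration_single] at this
    obtain ⟨s, t, rfl⟩ := exists_eq_blockPerm hpn (g := g) fun i => by
      simpa [stdFan] using hL.mem_I i
    refine ⟨s, t, (isTransition_iff hpn).2 ⟨fun K => ?_, L.symm, fun i => ?_⟩⟩
    · have e := map_hull L.toLinearMap
        ((fun i => stdVec ħ'.1 (Fin.castLE hpn i)) '' (K : Set (Fin p)))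
      rw [LinearEquiv.coe_coe, image_map_equiv s (v' := fun i => stdVec ħ.1 (Fin.castLE hpn i)) L
        (fun i => by rw [hvec, blockPerm_castLE])] at e
      rw [← hull_mem_conesOf_iff hA.toIsVertexComplex ((mem_realizableSet_iff hpn hA).1 ħ'.2) K,
        ← hull_mem_conesOf_iff hA.toIsVertexComplex ((mem_realizableSet_iff hpn hA).1 ħ.2), ← e]
      exact hL.map_cone _
    · rw [← hvec, L.symm_apply_apply]
  · rintro ⟨s, t, h⟩
    obtain ⟨hs, L, hL⟩ := (isTransition_iff hpn).1 h
    exact (stdFan_isRelabelling hpn ħ' ħ (blockPerm_castLE hpn s t) hs L hL).isIsomorphic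

theorem toModuli_surjective (hdn : d ≤ n) (hpn : p ≤ n) (hA : IsAdaptedComplex d D')
    (hD' : IsAdaptedNumbering d D D') : Function.Surjective (toModuli (d := d) hpn hD') := by
  intro x
  induction x using Quotient.inductionOn with
  | h x =>
  obtain ⟨F, hS, hM, e, he⟩ := x
  obtain ⟨s, hs⟩ := hD'.1
  have hQ : F.fan.IsQuantumFan := F.isQuantumFan
  let e' : Fin p ≃ F.I := s.symm.trans e
  have he' : ∀ K : Finset (Fin p), K ∈ D' ↔ K.map e'.toEmbedding ∈ F.fan.comb := by
    intro K
    have h1 : (K.map s.symm.toEmbedding).map s.toEmbedding = K := by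
      rw [Finset.map_map]; simp
    have h2 : (K.map s.symm.toEmbedding).map e.toEmbedding = K.map e'.toEmbedding := by
      rw [Finset.map_map]; rfl
    rw [← h2, ← he, hs, h1]
  let c : {i : Fin n // i.val < p} ≃ Fin p :=
    { toFun := fun i => ⟨i.1, i.2⟩
      invFun := fun i => ⟨Fin.castLE hpn i, by simp⟩
      left_inv := fun i => rfl
      right_inv := fun i => rfl }
  -- Any extension of the numbering of the `1`-cones to all of `Fin n` works: the remaining indices
  -- fall in the complement of `F.I`, which is `F.J`.
  let g : Equiv.Perm (Fin n) := (c.trans e').extendSubtype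
  have hg : ∀ i, g (Fin.castLE hpn i) = (e' i).1 := by
    intro i
    exact Equiv.extendSubtype_apply_of_mem (c.trans e') (Fin.castLE hpn i) (by simp)
  have hI : ∀ i : Fin n, i.val < p ↔ g i ∈ F.I := fun i =>
    ⟨fun hi => Equiv.extendSubtype_mem (c.trans e') i hi, fun hi => by
      by_contra hi'
      exact Equiv.extendSubtype_not_mem (c.trans e') i hi' hi⟩
  have hw : IsConeInjective D' fun i => F.h (Pi.single (g (Fin.castLE hpn i)) 1) := by
    simp only [hg]
    exact (hQ.isConeInjective hS).reindex e' fun K hK => (he' K).1 hK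
  obtain ⟨L, hL⟩ := exists_stdVec_normalise hdn (w := fun i => F.h (Pi.single (g i) 1))
    (hw.linearIndependent_castLE hA)
  refine ⟨⟨_, normalise_mem_realizableSet hdn hpn hA (w := fun i => F.h (Pi.single (g i) 1)) hw⟩,
    Quotient.sound ?_⟩
  refine CalibratedQuantumFan.IsRelabelling.isIsomorphic (g := g) (L := L.symm)
    ⟨fun i => ?_, fun i => ?_, fun i => ?_, fun σ => ?_⟩
  · simpa [stdFan] using hI i
  · rw [hM.J_eq, Finset.mem_compl, ← hI]
    simp [stdFan]
  · change L.symm (stdCalibration _ _) = F.h _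
    rw [stdCalibration_single, hL, L.symm_apply_apply]
  · have h1 := mem_cones_iff_map e' he' (v := fun i : Fin p =>
      stdVec (normalise hdn fun i => F.h (Pi.single (g i) 1)) (Fin.castLE hpn i))
      (v' := F.fan.gen) L.symm (fun i => by rw [hL, L.symm_apply_apply, hg]; rfl) σ
    rw [← hQ.cones_eq hS] at h1
    exact h1

theorem renumber_mem_realizableSet (hdn : d ≤ n) (hpn : p ≤ n) (hA' : IsAdaptedComplex d D')
    (hA'' : IsAdaptedComplex d D'') {g : Equiv.Perm (Fin n)} {s : Equiv.Perm (Fin p)}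
    (hg : ∀ i, g (Fin.castLE hpn i) = Fin.castLE hpn (s i))
    (hs : ∀ K : Finset (Fin p), K ∈ D' ↔ K.map s.toEmbedding ∈ D'') {ħ : CalibrationSpace d n}
    (hħ : ħ ∈ realizableSet hpn D'') : renumber hdn g ħ ∈ realizableSet hpn D' :=
  normalise_mem_realizableSet hdn hpn hA' (w := fun i => stdVec ħ (g i))
    (isConeInjective_renumber hpn hA'' hg hs hħ)

/-- Renumbering is a continuous map from the `U` of `D''` to the `U` of `D'` that commutes with the
maps to the moduli space. The virtual generators can stay in place, whence `t = 1`. -/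
theorem coinduced_toModuli_le (hdn : d ≤ n) (hpn : p ≤ n) (hA' : IsAdaptedComplex d D')
    (hA'' : IsAdaptedComplex d D'') (hD' : IsAdaptedNumbering d D D')
    (hD'' : IsAdaptedNumbering d D D'') :
    TopologicalSpace.coinduced (toModuli (d := d) hpn hD'') inferInstance ≤
      TopologicalSpace.coinduced (toModuli (d := d) hpn hD') inferInstance := by
  obtain ⟨s', hs'⟩ := hD'.1
  obtain ⟨s'', hs''⟩ := hD''.1
  let s : Equiv.Perm (Fin p) := s'.symm.trans s''
  have hs : ∀ K : Finset (Fin p), K ∈ D' ↔ K.map s.toEmbedding ∈ D'' := by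
    intro K
    have h1 : (K.map s'.symm.toEmbedding).map s'.toEmbedding = K := by
      rw [Finset.map_map]; simp
    have h2 : (K.map s'.symm.toEmbedding).map s''.toEmbedding = K.map s.toEmbedding := by
      rw [Finset.map_map]; rfl
    rw [← h2, ← hs'', hs', h1]
  have hg := blockPerm_castLE hpn s 1
  let f : realizableSet (d := d) hpn D'' → realizableSet (d := d) hpn D' := fun ħ =>
    ⟨renumber hdn (blockPerm hpn s 1) ħ.1,
      renumber_mem_realizableSet hdn hpn hA' hA'' hg hs ħ.2⟩
  have hf : Continuous f := by
    refine Continuous.subtype_mk (continuous_iff_continuousAt.2 fun ħ => ?_) _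
    exact ((contDiffAt_renumber hdn hpn hA' (isConeInjective_renumber hpn hA'' hg hs
      ħ.2)).continuousAt).comp continuous_subtype_val.continuousAt
  have hcomp : toModuli hpn hD'' = toModuli hpn hD' ∘ f := by
    ext1 ħ
    refine (Eq.symm ((toModuli_eq_iff_isIsomorphic hpn hD' hD'' (f ħ) ħ).2 ?_))
    obtain ⟨L, hL⟩ := exists_stdVec_normalise hdn (w := fun i => stdVec ħ.1 (blockPerm hpn s 1 i))
      ((isConeInjective_renumber hpn hA'' hg hs ħ.2).linearIndependent_castLE hA')
    exact (stdFan_isRelabelling hpn (f ħ) ħ hg hs L hL).isIsomorphic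
  rw [hcomp, ← coinduced_compose]
  exact coinduced_mono (continuous_iff_coinduced_le.1 hf)

theorem isQuotientMap_toModuli (hdn : d ≤ n) (hpn : p ≤ n) (hD : IsCombinatorialType d D)
    (hcone : ∃ K ∈ D, K.card = d) (hD' : IsAdaptedNumbering d D D') :
    IsQuotientMap (toModuli (d := d) hpn hD') := by
  have hA := fun D' => hD.isAdaptedComplex hcone (D' := D')
  have h : (inferInstance : TopologicalSpace (ModuliSpace d hpn D)) =
      TopologicalSpace.coinduced (toModuli (d := d) hpn hD') inferInstance := by
    -- The term of `D'` bounds every other term, so it equals the supremum that defines the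
    -- topology.
    refine le_antisymm (iSup_le fun D'' => ?_) (le_iSup (fun D' : {D' // IsAdaptedNumbering d D D'}
      => TopologicalSpace.coinduced (toModuli (d := d) hpn D'.2) inferInstance) ⟨D', hD'⟩)
    exact coinduced_toModuli_le hdn hpn (hA _ hD') (hA _ D''.2) hD' D''.2
  exact ⟨⟨h⟩, toModuli_surjective hdn hpn (hA _ hD') hD'⟩

end Moduli

/-! ## Manifolds étale over a vector space -/

section Etale

variable {V : Type} [NormedAddCommGroup V] [NormedSpace ℝ V]
  {M : Type} [TopologicalSpace M] {N : Type} [TopologicalSpace N]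

/-- The charted space structure whose charts are the restrictions of a local homeomorphism to the
model space. -/
abbrev IsLocalHomeomorph.etaleChartedSpace {f : M → V} (hf : IsLocalHomeomorph f) :
    ChartedSpace V M where
  atlas := {e | Set.EqOn e f e.source}
  chartAt x := (hf x).choose
  mem_chart_source x := (hf x).choose_spec.1
  chart_mem_atlas x := fun y _ => (congrFun (hf x).choose_spec.2 y).symm

variable [ChartedSpace V M] [ChartedSpace V N]

/-- The charts of `M` are restrictions of `f`. -/
def IsEtaleAtlas (f : M → V) : Prop :=
  ∀ e ∈ atlas V M, Set.EqOn e f e.source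

namespace IsEtaleAtlas

variable {f : M → V} {f' : N → V}

/-- All charts are restrictions of the same `f`, so the changes of charts are identities. -/
theorem isManifold (hf : IsEtaleAtlas f) : IsManifold 𝓘(ℝ, V) ∞ M := by
  refine isManifold_of_contDiffOn _ _ _ fun e e' he he' => contDiffOn_id.congr fun z hz => ?_
  have hz' : z ∈ e.target ∧ e.symm z ∈ e'.source := by simpa using hz
  change e' (e.symm z) = z
  rw [hf e' he' hz'.2, ← hf e he (e.map_target hz'.1), e.right_inv hz'.1]

/-- In charts that restrict `f` and `f'`, the map `F` reads as `T`. -/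
theorem contMDiffAt (hf : IsEtaleAtlas f) (hf' : IsEtaleAtlas f') {F : M → N} {T : V → V} {x : M}
    (hF : ContinuousAt F x) (hT : ContDiffAt ℝ ∞ T (f x)) (h : ∀ᶠ y in 𝓝 x, f' (F y) = T (f y)) :
    ContMDiffAt 𝓘(ℝ, V) 𝓘(ℝ, V) ∞ F x := by
  rw [contMDiffAt_iff]
  refine ⟨hF, ?_⟩
  set e := chartAt V x with he
  set e' := chartAt V (F x) with he'
  have hex : e x = f x := hf e (chart_mem_atlas V x) (mem_chart_source V x)
  have hx : extChartAt 𝓘(ℝ, V) x x = f x := by simpa using hex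
  rw [hx]
  refine (hT.congr_of_eventuallyEq ?_).contDiffWithinAt
  have htar : ∀ᶠ z in 𝓝 (f x), z ∈ e.target := by
    rw [← hex]
    exact e.open_target.mem_nhds (e.map_source (mem_chart_source V x))
  have hsymm : Filter.Tendsto e.symm (𝓝 (f x)) (𝓝 x) := by
    have := e.continuousAt_symm (e.map_source (mem_chart_source V x))
    rw [ContinuousAt, e.left_inv (mem_chart_source V x), hex] at this
    exact this
  have hsrc : ∀ᶠ y in 𝓝 x, F y ∈ e'.source :=
    hF.eventually (e'.open_source.mem_nhds (mem_chart_source V (F x)))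
  filter_upwards [htar, hsymm.eventually hsrc, hsymm.eventually h] with z h1 h2 h3
  have h4 : e' (F (e.symm z)) = T z := by
    rw [hf' e' (chart_mem_atlas V _) h2, h3, ← hf e (chart_mem_atlas V x) (e.map_target h1),
      e.right_inv h1]
  simpa using h4

/-- The chart at `x`, as a partial diffeomorphism. -/
def chartDiffeo (hf : IsEtaleAtlas f) (x : M) :
    PartialDiffeomorph 𝓘(ℝ, V) 𝓘(ℝ, V) M V ∞ :=
  have := hf.isManifold
  { (chartAt V x).toPartialEquiv with
    open_source := (chartAt V x).open_source
    open_target := (chartAt V x).open_target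
    contMDiffOn_toFun := contMDiffOn_of_mem_maximalAtlas (IsManifold.chart_mem_maximalAtlas x)
    contMDiffOn_invFun :=
      contMDiffOn_symm_of_mem_maximalAtlas (IsManifold.chart_mem_maximalAtlas x) }

theorem isLocalDiffeomorph (hf : IsEtaleAtlas f) :
    IsLocalDiffeomorph 𝓘(ℝ, V) 𝓘(ℝ, V) ∞ f := fun x =>
  ⟨hf.chartDiffeo x, mem_chart_source V x, fun _ hy => (hf _ (chart_mem_atlas V x) hy).symm⟩

/-- A lift of an étale map along an injective étale map is étale. -/
theorem isLocalDiffeomorph_of_comp_eq (hf : IsEtaleAtlas f) (hf' : IsEtaleAtlas f')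
    (hinj : Function.Injective f') {F : M → N} (hF : ∀ x, f' (F x) = f x) :
    IsLocalDiffeomorph 𝓘(ℝ, V) 𝓘(ℝ, V) ∞ F := by
  intro x
  have h1 : ∀ y ∈ (chartAt V x).source, chartAt V x y = f y := hf _ (chart_mem_atlas V x)
  have h2 : ∀ y ∈ (chartAt V (F x)).source, chartAt V (F x) y = f' y :=
    hf' _ (chart_mem_atlas V (F x))
  -- The chart at `x` followed by the inverse of the chart at `F x` agrees with `F`, since both have
  -- the same image under the injective `f'`.
  refine ⟨(hf.chartDiffeo x).trans (hf'.chartDiffeo (F x)).symm, ⟨mem_chart_source V x, ?_⟩, ?_⟩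
  · change chartAt V x x ∈ (chartAt V (F x)).target
    rw [h1 x (mem_chart_source V x), ← hF, ← h2 _ (mem_chart_source V (F x))]
    exact (chartAt V (F x)).map_source (mem_chart_source V (F x))
  · rintro y ⟨hy1, hy2⟩
    change chartAt V x y ∈ (chartAt V (F x)).target at hy2
    change F y = (chartAt V (F x)).symm (chartAt V x y)
    refine hinj ?_
    rw [← h2 _ ((chartAt V (F x)).map_target hy2), (chartAt V (F x)).right_inv hy2, hF, h1 y hy1]

end IsEtaleAtlas

end Etale

/-! ## The orbifold of a finite group of transformations -/

section Sigma

variable {G U X V : Type} [TopologicalSpace U] [TopologicalSpace X] [TopologicalSpace V]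

/-- Locally the map stays in a single sheet of the disjoint union. This serves for the composition
of arrows. -/
theorem continuous_sigma_mk_of_isLocallyConstant {a : X → G} {b : X → U}
    (ha : IsLocallyConstant a) (hb : Continuous b) :
    Continuous fun x => (⟨a x, b x⟩ : Σ _ : G, U) := by
  refine continuous_iff_continuousAt.2 fun x => ?_
  have h : Continuous fun y => (⟨a x, b y⟩ : Σ _ : G, U) := continuous_sigmaMk.comp hb
  refine h.continuousAt.congr ?_
  filter_upwards [ha.eventually_eq x] with y hy
  rw [hy]

theorem isLocallyConstant_sigma_fst :
    IsLocallyConstant (Sigma.fst : (Σ _ : G, U) → G) := by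
  refine IsLocallyConstant.iff_eventually_eq _ |>.2 ?_
  rintro ⟨a, x⟩
  rw [Sigma.nhds_mk, Filter.eventually_map]
  exact Filter.Eventually.of_forall fun _ => rfl

theorem isLocalHomeomorph_sigma {f : U → V} (hf : IsOpenEmbedding f) :
    IsLocalHomeomorph fun g : Σ _ : G, U => f g.2 := by
  refine IsLocalHomeomorph.mk _ ?_
  rintro ⟨a, x⟩
  have : Nonempty U := ⟨x⟩
  have hmk : IsOpenEmbedding fun y : U => (⟨a, y⟩ : Σ _ : G, U) :=
    IsOpenEmbedding.sigmaMk (σ := fun _ => U)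
  refine ⟨(hmk.toOpenPartialHomeomorph _).symm.trans (hf.toOpenPartialHomeomorph _), by simp, ?_⟩
  rintro ⟨b, y⟩ hy
  obtain ⟨z, hz⟩ : (⟨b, y⟩ : Σ _ : G, U) ∈ Set.range (Sigma.mk a) := by simpa [eq_comm] using hy
  have := hmk.toOpenPartialHomeomorph_left_inv (x := z)
  rw [← hz]
  simp [this]

/-- With finitely many sheets, the image of a closed set is a finite union of closed sets, and the
fibres are finite. -/
theorem isProperMap_sigma_snd [Finite G] : IsProperMap fun g : Σ _ : G, U => g.2 := by
  rw [isProperMap_iff_isClosedMap_and_compact_fibers]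
  refine ⟨continuous_sigma fun _ => continuous_id, fun C hC => ?_, fun y => ?_⟩
  · have : (fun g : Σ _ : G, U => g.2) '' C = ⋃ a, Sigma.mk a ⁻¹' C := by
      ext x; simp
    rw [this]
    exact isClosed_iUnion_of_finite fun a => hC.preimage continuous_sigmaMk
  · refine Set.Finite.isCompact ((Set.finite_range fun a : G => (⟨a, y⟩ : Σ _ : G, U)).subset ?_)
    rintro ⟨a, x⟩ rfl
    exact ⟨a, rfl⟩

end Sigma

/-- A finite group `G` acting smoothly from the right on an open subset `U` of `V`. -/
structure SmoothRightAction (G : Type) [Group G] (V : Type) [NormedAddCommGroup V]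
    [NormedSpace ℝ V] (U : Set V) where
  act : G → V → V
  isOpen : IsOpen U
  act_mem : ∀ g, ∀ x ∈ U, act g x ∈ U
  contDiffAt : ∀ g, ∀ x ∈ U, ContDiffAt ℝ ∞ (act g) x
  one_act : ∀ x ∈ U, act 1 x = x
  -- The order of the factors is that of composing arrows, `g` first and then `g'`.
  mul_act : ∀ g g', ∀ x ∈ U, act (g * g') x = act g' (act g x)

namespace SmoothRightAction

variable {G : Type} [Group G] {V : Type} [NormedAddCommGroup V] [NormedSpace ℝ V] {U : Set V}
  (A : SmoothRightAction G V U)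

/-- The target of an arrow of the action groupoid. -/
def target (g : Σ _ : G, U) : U := ⟨A.act g.1 g.2, A.act_mem _ _ g.2.2⟩

/-- The inverse of an arrow of the action groupoid. -/
def inverse (g : Σ _ : G, U) : Σ _ : G, U := ⟨g.1⁻¹, A.target g⟩

theorem target_inverse (g : Σ _ : G, U) : A.target (A.inverse g) = g.2 := by
  refine Subtype.ext ?_
  change A.act g.1⁻¹ (A.act g.1 g.2) = _
  rw [← A.mul_act _ _ _ g.2.2, mul_inv_cancel, A.one_act _ g.2.2]

theorem inverse_inverse (g : Σ _ : G, U) : A.inverse (A.inverse g) = g := by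
  change (⟨(g.1⁻¹)⁻¹, A.target (A.inverse g)⟩ : Σ _ : G, U) = g
  rw [target_inverse, inv_inv]

theorem continuous_target : Continuous A.target := by
  refine continuous_sigma fun a => Continuous.subtype_mk ?_ _
  exact continuous_iff_continuousAt.2 fun x =>
    (A.contDiffAt a x.1 x.2).continuousAt.comp continuous_subtype_val.continuousAt

theorem continuous_inverse : Continuous A.inverse := by
  refine continuous_sigma fun a => ?_
  exact (continuous_sigmaMk (σ := fun _ : G => U) (i := a⁻¹)).comp
    (A.continuous_target.comp (continuous_sigmaMk (σ := fun _ : G => U) (i := a)))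

/-- The orbit space of a smooth action of a finite group on an open subset of `V` is an orbifold,
presented by the action groupoid. -/
def orbifold [Finite G] [SecondCountableTopology V] {X : Type} [TopologicalSpace X] (π : U → X)
    (hπ : IsQuotientMap π)
    (h : ∀ x y : U, π x = π y ↔ ∃ g, A.act g x = y) : RealOrbifoldStructure V X :=
  have hU : IsOpenEmbedding (Subtype.val : U → V) := A.isOpen.isOpenEmbedding_subtypeVal
  letI : ChartedSpace V U := hU.isLocalHomeomorph.etaleChartedSpace
  letI : ChartedSpace V (Σ _ : G, U) := (isLocalHomeomorph_sigma hU).etaleChartedSpace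
  have eU : IsEtaleAtlas (Subtype.val : U → V) := fun _ he => he
  have eA : IsEtaleAtlas (fun g : Σ _ : G, U => (g.2 : V)) := fun _ he => he
  have hinv : ContMDiff 𝓘(ℝ, V) 𝓘(ℝ, V) ∞ A.inverse := fun g =>
    -- The group component is locally constant, so in charts the inversion is the action of one
    -- fixed element.
    eA.contMDiffAt eA A.continuous_inverse.continuousAt (A.contDiffAt g.1 g.2 g.2.2)
      ((isLocallyConstant_sigma_fst.eventually_eq g).mono fun g' hg' => by
        change A.act g'.1 g'.2 = A.act g.1 g'.2
        rw [hg'])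
  have hsrc : IsLocalDiffeomorph 𝓘(ℝ, V) 𝓘(ℝ, V) ∞ fun g : Σ _ : G, U => g.2 :=
    eA.isLocalDiffeomorph_of_comp_eq eU Subtype.val_injective fun _ => rfl
  { Obj := U
    Arr := Σ _ : G, U
    manifoldObj := eU.isManifold
    manifoldArr := eA.isManifold
    src := fun g => g.2
    tgt := A.target
    one := fun x => ⟨1, x⟩
    inv := A.inverse
    comp := fun g g' _ => ⟨g.1 * g'.1, g.2⟩
    src_one := fun _ => rfl
    tgt_one := fun x => Subtype.ext (A.one_act x x.2)
    src_inv := fun _ => rfl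
    tgt_inv := A.target_inverse
    src_comp := fun _ _ _ => rfl
    tgt_comp := fun g g' h => Subtype.ext <| by
      change A.act (g.1 * g'.1) g.2 = A.act g'.1 g'.2
      rw [A.mul_act _ _ _ g.2.2, ← h]
      rfl
    one_comp := fun g => by
      change (⟨1 * g.1, g.2⟩ : Σ _ : G, U) = g
      rw [one_mul]
    comp_one := fun g => by
      change (⟨g.1 * 1, g.2⟩ : Σ _ : G, U) = g
      rw [mul_one]
    comp_inv := fun g => by
      change (⟨g.1 * g.1⁻¹, g.2⟩ : Σ _ : G, U) = ⟨1, g.2⟩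
      rw [mul_inv_cancel]
    inv_comp := fun g => by
      change (⟨g.1⁻¹ * g.1, A.target g⟩ : Σ _ : G, U) = ⟨1, A.target g⟩
      rw [inv_mul_cancel]
    assoc := fun g g' g'' _ _ => by
      change (⟨g.1 * g'.1 * g''.1, g.2⟩ : Σ _ : G, U) = ⟨g.1 * (g'.1 * g''.1), g.2⟩
      rw [mul_assoc]
    src_localDiffeo := hsrc
    tgt_localDiffeo := fun g => by
      -- The target map is the source map composed with inversion, a smooth involution.
      let Φ : Diffeomorph 𝓘(ℝ, V) 𝓘(ℝ, V) (Σ _ : G, U) (Σ _ : G, U) ∞ :=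
        { toFun := A.inverse
          invFun := A.inverse
          left_inv := A.inverse_inverse
          right_inv := A.inverse_inverse
          contMDiff_toFun := hinv
          contMDiff_invFun := hinv }
      exact (Φ.isLocalDiffeomorph g).comp (K := 𝓘(ℝ, V)) (hg := hsrc (A.inverse g))
    one_smooth := fun x => eU.contMDiffAt eA continuous_sigmaMk.continuousAt
      contDiffAt_id (Filter.Eventually.of_forall fun _ => rfl)
    inv_smooth := hinv
    comp_continuous := by
      refine continuous_sigma_mk_of_isLocallyConstant ?_ ?_
      · exact IsLocallyConstant.mul
          (isLocallyConstant_sigma_fst.comp_continuous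
            (continuous_fst.comp continuous_subtype_val))
          (isLocallyConstant_sigma_fst.comp_continuous
            (continuous_snd.comp continuous_subtype_val))
      · exact isProperMap_sigma_snd.continuous.comp (continuous_fst.comp continuous_subtype_val)
    -- The first component of the map is the source, which is already proper, and `U × U` is
    -- Hausdorff.
    proper := isProperMap_of_comp_of_t2
      (isProperMap_sigma_snd.continuous.prodMk A.continuous_target) continuous_fst
      isProperMap_sigma_snd
    finite_isotropy := fun x => by
      refine (Set.finite_range fun a : G => (⟨a, x⟩ : Σ _ : G, U)).subset ?_
      rintro ⟨a, y⟩ ⟨rfl, -⟩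
      exact ⟨a, rfl⟩
    proj := π
    proj_quotientMap := hπ
    proj_eq_iff := fun x y => by
      rw [h]
      constructor
      · rintro ⟨g, hg⟩
        exact ⟨⟨g, x⟩, rfl, Subtype.ext hg⟩
      · rintro ⟨⟨g, x⟩, rfl, hg⟩
        exact ⟨g, congrArg Subtype.val hg⟩ }

theorem orbifold_isLocalDiffeomorph [Finite G] [SecondCountableTopology V] {X : Type}
    [TopologicalSpace X] (π : U → X) (hπ : IsQuotientMap π)
    (h : ∀ x y : U, π x = π y ↔ ∃ g, A.act g x = y) :
    IsLocalDiffeomorph 𝓘(ℝ, V) 𝓘(ℝ, V) ∞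
      fun x : (A.orbifold π hπ h).Obj => Subtype.val (p := (· ∈ U)) x :=
  IsEtaleAtlas.isLocalDiffeomorph (M := (A.orbifold π hπ h).Obj) fun _ he => he

end SmoothRightAction

/-! ## The moduli space as an orbifold -/

section Transition

variable {d n p : ℕ} {D : Set (Finset (Fin p))}

/-- The pairs `(s, t)` for which `s` preserves `D`. -/
def complexStabilizer (D : Set (Finset (Fin p))) (q : ℕ) :
    Subgroup (Equiv.Perm (Fin p) × Equiv.Perm (Fin q)) where
  carrier := {st | ∀ K : Finset (Fin p), K ∈ D ↔ K.map st.1.toEmbedding ∈ D}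
  one_mem' K := by
    change K ∈ D ↔ K.map (Function.Embedding.refl _) ∈ D
    rw [Finset.map_refl]
  mul_mem' {a b} ha hb K := by
    rw [hb, ha, Finset.map_map]
    rfl
  inv_mem' {a} ha K := by
    have h := ha (K.map (a.1⁻¹).toEmbedding)
    rw [Finset.map_map] at h
    have e : (a.1⁻¹).toEmbedding.trans a.1.toEmbedding = Function.Embedding.refl _ := by
      ext i; simp
    rw [e, Finset.map_refl] at h
    exact h.symm

theorem renumber_one (hdn : d ≤ n) (ħ : CalibrationSpace d n) : renumber hdn 1 ħ = ħ :=
  (eq_normalise hdn (LinearEquiv.refl ℝ _) fun _ => rfl).symm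

/-- The composite of the two normalising maps sends `stdVec ħ (g (g' i))` to the standard vectors of
the right-hand side, so `eq_normalise` applies. The order of `g` and `g'` makes this a right action.
-/
theorem renumber_mul (hdn : d ≤ n) (g g' : Equiv.Perm (Fin n)) {ħ : CalibrationSpace d n}
    (h : LinearIndependent ℝ fun i => stdVec ħ (g (Fin.castLE hdn i)))
    (h' : LinearIndependent ℝ fun i => stdVec (renumber hdn g ħ) (g' (Fin.castLE hdn i))) :
    renumber hdn (g * g') ħ = renumber hdn g' (renumber hdn g ħ) := by
  obtain ⟨L, hL⟩ := exists_stdVec_normalise hdn (w := fun i => stdVec ħ (g i)) h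
  obtain ⟨L', hL'⟩ := exists_stdVec_normalise hdn
    (w := fun i => stdVec (renumber hdn g ħ) (g' i)) h'
  refine (eq_normalise hdn (L.trans L') fun i => ?_).symm
  exact (hL' i).trans (congrArg L' (hL (g' i)))

theorem linearIndependent_of_mem_realizableSet (hpn : p ≤ n) (hD : IsAdaptedComplex d D)
    (hdn : d ≤ n) {s : Equiv.Perm (Fin p)}
    (hs : ∀ K : Finset (Fin p), K ∈ D ↔ K.map s.toEmbedding ∈ D) (t : Equiv.Perm (Fin (n - p)))
    {ħ : CalibrationSpace d n} (hħ : ħ ∈ realizableSet hpn D) :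
    LinearIndependent ℝ fun i => stdVec ħ (blockPerm hpn s t (Fin.castLE hdn i)) :=
  (isConeInjective_renumber hpn hD (blockPerm_castLE hpn s t) hs hħ).linearIndependent_castLE hD

/-- Since `L` is forced by `ħ` and `(s, t)`, a transition is the graph of a map. This turns the
equivalence relation on `U` into the orbit relation of a group. -/
theorem isTransition_iff_renumber (hpn : p ≤ n) (hD : IsAdaptedComplex d D) (hdn : d ≤ n)
    {s : Equiv.Perm (Fin p)} {t : Equiv.Perm (Fin (n - p))} {ħ ħ' : CalibrationSpace d n}
    (hħ : ħ ∈ realizableSet hpn D) :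
    IsTransition hpn D s t ħ ħ' ↔
      (s, t) ∈ complexStabilizer D (n - p) ∧ renumber hdn (blockPerm hpn s t) ħ = ħ' := by
  rw [isTransition_iff hpn]
  refine and_congr_right fun hs => ⟨?_, ?_⟩
  · rintro ⟨L, hL⟩
    exact (eq_normalise hdn L hL).symm
  · rintro rfl
    exact exists_stdVec_normalise hdn (w := fun i => stdVec ħ (blockPerm hpn s t i))
      (linearIndependent_of_mem_realizableSet hpn hD hdn hs t hħ)

/-- The right action of the pairs `(s, t)` on the realizable calibrations. -/
def transitionAction (hpn : p ≤ n) (hD : IsAdaptedComplex d D) (hdn : d ≤ n) :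
    SmoothRightAction (complexStabilizer D (n - p)) (CalibrationSpace d n)
      (realizableSet hpn D) where
  act g := renumber hdn (blockPerm hpn g.1.1 g.1.2)
  isOpen := isOpen_realizableSet hpn hD
  act_mem g _ hħ := renumber_mem_realizableSet hdn hpn hD hD (blockPerm_castLE hpn _ _) g.2 hħ
  contDiffAt g _ hħ := contDiffAt_renumber hdn hpn hD
    (isConeInjective_renumber hpn hD (blockPerm_castLE hpn _ _) g.2 hħ)
  one_act ħ _ := by
    change renumber hdn (blockPerm hpn 1 1) ħ = ħ
    rw [blockPerm_one, renumber_one]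
  mul_act g g' ħ hħ := by
    change renumber hdn (blockPerm hpn (g.1.1 * g'.1.1) (g.1.2 * g'.1.2)) ħ = _
    rw [blockPerm_mul, renumber_mul]
    · exact linearIndependent_of_mem_realizableSet hpn hD hdn g.2 _ hħ
    · exact linearIndependent_of_mem_realizableSet hpn hD hdn g'.2 _
        (renumber_mem_realizableSet hdn hpn hD hD (blockPerm_castLE hpn _ _) g.2 hħ)

end Transition

end

theorem mainTheorem9 (d n p : ℕ) (hd : 0 < d) (hdn : d < n) (hpn : p ≤ n)
    (D : Set (Finset (Fin p))) (hD : IsCombinatorialType d D)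
    (hcone : ∃ K ∈ D, K.card = d) :
    Module.finrank ℝ (CalibrationSpace d n) = d * (n - d) ∧
    (∃ D', IsAdaptedNumbering d D D') ∧
    ∀ (D' : Set (Finset (Fin p))) (hD' : IsAdaptedNumbering d D D'),
      IsOpen (realizableSet (d := d) hpn D') ∧
      IsQuotientMap (toModuli (d := d) hpn hD') ∧
      (∀ ħ ħ' : realizableSet (d := d) hpn D',
        toModuli hpn hD' ħ = toModuli hpn hD' ħ' ↔
          ∃ (s : Equiv.Perm (Fin p)) (t : Equiv.Perm (Fin (n - p))),
            IsTransition hpn D' s t ħ.1 ħ'.1) ∧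
      ∃ (𝒪 : RealOrbifoldStructure (CalibrationSpace d n) (ModuliSpace d hpn D))
        (e : 𝒪.Obj → realizableSet (d := d) hpn D')
        (φ : 𝒪.Arr → Equiv.Perm (Fin p) × Equiv.Perm (Fin (n - p))),
        Function.Bijective e ∧
        IsLocalDiffeomorph 𝓘(ℝ, CalibrationSpace d n) 𝓘(ℝ, CalibrationSpace d n) ∞
          (fun x => (e x : CalibrationSpace d n)) ∧
        (∀ x, 𝒪.proj x = toModuli hpn hD' (e x)) ∧
        (∀ x y, Set.BijOn φ {g | 𝒪.src g = x ∧ 𝒪.tgt g = y}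
          {st | IsTransition hpn D' st.1 st.2 (e x).1 (e y).1}) ∧
        ∀ g g' h, φ (𝒪.comp g g' h) = φ g * φ g' := by
  refine ⟨?_, exists_isAdaptedNumbering hcone, fun D' hD' => ?_⟩
  · rw [Module.finrank_pi_fintype]
    simp [mul_comm]
  have hA : IsAdaptedComplex d D' := hD.isAdaptedComplex hcone hD'
  have hq : IsQuotientMap (toModuli (d := d) hpn hD') :=
    isQuotientMap_toModuli hdn.le hpn hD hcone hD'
  have hiff := toModuli_eq_iff hpn hA hD'
  have hact : ∀ ħ ħ' : realizableSet (d := d) hpn D',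
      toModuli hpn hD' ħ = toModuli hpn hD' ħ' ↔
        ∃ g, (transitionAction hpn hA hdn.le).act g ħ = ħ' := by
    intro ħ ħ'
    rw [hiff]
    constructor
    · rintro ⟨s, t, h⟩
      obtain ⟨hst, h⟩ := (isTransition_iff_renumber hpn hA hdn.le ħ.2).1 h
      exact ⟨⟨(s, t), hst⟩, h⟩
    · rintro ⟨⟨⟨s, t⟩, hst⟩, h⟩
      exact ⟨s, t, (isTransition_iff_renumber hpn hA hdn.le ħ.2).2 ⟨hst, h⟩⟩
  refine ⟨isOpen_realizableSet hpn hA, hq, hiff,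
    (transitionAction hpn hA hdn.le).orbifold (toModuli hpn hD') hq hact, fun x => x,
    fun g => g.1.1, Function.bijective_id,
    (transitionAction hpn hA hdn.le).orbifold_isLocalDiffeomorph _ hq hact, fun _ => rfl,
    fun x y => ⟨?_, ?_, ?_⟩, fun _ _ _ => rfl⟩
  · rintro ⟨g, x⟩ ⟨rfl, rfl⟩
    exact (isTransition_iff_renumber hpn hA hdn.le x.2).2 ⟨g.2, rfl⟩
  -- An arrow is determined by its source and its pair of permutations.
  · rintro ⟨g, x'⟩ ⟨h, -⟩ ⟨g', x''⟩ ⟨h', -⟩ hgg'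
    exact Sigma.ext (Subtype.ext hgg') (heq_of_eq (h.trans h'.symm))
  · rintro ⟨s, t⟩ hst
    obtain ⟨hst, h⟩ := (isTransition_iff_renumber hpn hA hdn.le x.2).1 hst
    exact ⟨⟨⟨(s, t), hst⟩, x⟩, ⟨rfl, Subtype.ext h⟩, rfl⟩
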